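/- For vectors of positive reals $r=(r_1,\dots,r_m)$, $c=(c_1,\dots,c_n)$ and a positive integer $k\le\min(m,n)$, let $E(k,r,c)=E(k,r_1,\dots,r_m,c)$ denote the expected value of $\min_k(X)$, where $X=(x_{ij})$ is an $m\times n$ matrix with independent entries, $x_{ij}$ exponentially distributed with rate $r_ic_j$ (density $r_ic_je^{-r_ic_jx}$ on $x\ge 0$), and $\min_k(X)$ is the minimum sum of $k$ entries of $X$, no two of which lie in the same row or column. For $K\subseteq\{1,\dots,n\}$ with $|K|=t$, let $\Pr(c,K)$ be the probability that $K$ is the set of the first $t$ balls drawn when balls $1,\dots,n$ are drawn one at a time without replacement from an urn, each draw choosing a remaining ball $j$ with probability proportional to its weight $c_j$; that is, $$\Pr(c,K)=\sum_{\pi}\prod_{i=1}^{t}\frac{c_{\pi_i}}{\sum_{j=1}^n c_j-\sum_{j=1}^{i-1}c_{\pi_j}},$$ the sum being over all $t!$ orderings $\pi=(\pi_1,\dots,\pi_t)$ of $K$. Let $c'(K)$ denote the vector $(c_j)_{j\notin K}$. **Theorem.** Let $1\le k\le m\le n$ and $0\le l\le m$ be integers, and let $r_{l+1},\dots,r_m$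 and $c_1,\dots,c_n$ be fixed positive real numbers. In the following limits $(r_1,\dots,r_l)$ tends jointly to $(0,\dots,0)$ through $l$-tuples of positive real numbers. 1. If $k\le m-l$, then $$\lim_{r_1,\dots,r_l\to0}E(k,r_1,\dots,r_m,c)=E(k,r_{l+1},\dots,r_m,c).$$ 2. If $k>m-l>0$, then $$\lim_{r_1,\dots,r_l\to0}\bigl(E(k,r_1,\dots,r_m,c)-E(k+l-m,r_1,\dots,r_l,c)\bigr)=\sum_{K\subseteq\{1,\dots,n\},\ |K|=k+l-m}\Pr(c,K)\,E(m-l,r_{l+1},\dots,r_m,c'(K)).$$ -/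

import Mathlib

open MeasureTheory ProbabilityTheory

namespace MinAssign

noncomputable section

/-- A `k`-assignment of a matrix with rows `ι` and columns `κ`: a set of `k` positions, no two of
which lie in the same row or in the same column. -/
def IsAssignment {ι κ : Type*} (k : ℕ) (σ : Finset (ι × κ)) : Prop :=
  σ.card = k ∧ (∀ p ∈ σ, ∀ q ∈ σ, p.1 = q.1 → p = q) ∧ (∀ p ∈ σ, ∀ q ∈ σ, p.2 = q.2 → p = q)

/-- `min_k(X)`, the smallest sum of entries of `X` over a `k`-assignment. For finite `ι`, `κ` this
is the infimum of a finite family, nonempty exactly when `k ≤ #ι` and `k ≤ #κ`, so then it is a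
minimum. -/
def minAssign {ι κ : Type*} (k : ℕ) (X : ι × κ → ℝ) : ℝ :=
  ⨅ σ : {σ : Finset (ι × κ) // IsAssignment k σ}, ∑ p ∈ σ.1, X p

/-- The law of the random exponential matrix with rate matrix `A`: the entries are independent,
and entry `p` is exponentially distributed with rate `A p`. -/
def expMatrixLaw {ι κ : Type*} [Fintype ι] [Fintype κ] (A : ι × κ → ℝ) : Measure (ι × κ → ℝ) :=
  Measure.pi fun p => expMeasure (A p)

/-- `E_k(A)`, the expected minimum `k`-assignment of the random exponential matrix with rate
matrix `A`. -/
def expMinAssign {ι κ : Type*} [Fintype ι] [Fintype κ] (k : ℕ) (A : ι × κ → ℝ) : ℝ :=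
  ∫ X, minAssign k X ∂(expMatrixLaw A)

/-- `E(k, r, c)`, the value of `E_k(A)` at the rank one rate matrix `A = (r_i c_j)`. -/
def E {ι κ : Type*} [Fintype ι] [Fintype κ] (k : ℕ) (r : ι → ℝ) (c : κ → ℝ) : ℝ :=
  expMinAssign k fun p => r p.1 * c p.2

/-- Balls labeled by `κ`, with weights `w`, are drawn one at a time without replacement, each draw
choosing a remaining ball with probability proportional to its weight. This is the probability
that the first `t` draws are `π 0, …, π (t - 1)` in this order: the product over the draws of the
weight of the ball drawn divided by the total weight of the balls still in the urn. -/
def drawProb {κ : Type*} [Fintype κ] (w : κ → ℝ) {t : ℕ} (π : Fin t → κ) : ℝ :=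
  ∏ i, w (π i) / (∑ a, w a - ∑ j ∈ Finset.univ.filter (fun j => j < i), w (π j))

/-- `Pr(w, K)`, the probability that the first `#K` balls drawn are those in `K`: the sum of the
probabilities of the `(#K)!` orderings of `K`. -/
def Pr {κ : Type*} [Fintype κ] [DecidableEq κ] (w : κ → ℝ) (K : Finset κ) : ℝ :=
  ∑ π : Fin K.card ≃ {a // a ∈ K}, drawProb w fun i => (π i : κ)

lemma integrable_expMeasure {a : ℝ} (ha : 0 < a) : Integrable (fun x : ℝ => x) (expMeasure a) := by
  have hf : Measurable (exponentialPDF a) := (measurable_exponentialPDFReal a).ennreal_ofReal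
  change Integrable _ (volume.withDensity (exponentialPDF a))
  rw [integrable_withDensity_iff_integrable_smul' hf
    (Filter.Eventually.of_forall fun x => ENNReal.ofReal_lt_top)]
  have h := integrableOn_rpow_mul_exp_neg_mul_rpow (s := 1) (p := 1) (b := a)
    (by norm_num) (by norm_num) ha
  have h2 := IntegrableOn.integrable_indicator (h.const_mul a) measurableSet_Ioi
  refine h2.congr (Filter.Eventually.of_forall fun x => ?_)
  rcases le_or_gt x 0 with hx | hx
  · rcases hx.lt_or_eq with hx | rfl
    · simp [Set.indicator, not_lt.2 hx.le, exponentialPDF_of_neg hx]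
    · simp [Set.indicator]
  · have : 0 ≤ a * Real.exp (-(a * x)) := by positivity
    simp [Set.indicator, hx, exponentialPDF_of_nonneg hx.le, ENNReal.toReal_ofReal this]
    ring

/-- The random variable `min_k` is integrable, so the integral defining `E_k(A)` is a genuine
expectation. -/
lemma integrable_minAssign {ι κ : Type*} [Fintype ι] [Fintype κ] (k : ℕ) {A : ι × κ → ℝ}
    (hA : ∀ p, 0 < A p) : Integrable (fun X : ι × κ → ℝ => minAssign k X) (expMatrixLaw A) := by
  have := fun p => isProbabilityMeasure_expMeasure (hA p)
  have hc : ∀ p, Integrable (fun X : ι × κ → ℝ => X p) (expMatrixLaw A) := fun p =>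
    (measurePreserving_eval (fun p => expMeasure (A p)) p).integrable_comp_of_integrable
      (integrable_expMeasure (hA p))
  have hs : ∀ σ : Finset (ι × κ), Integrable (fun X : ι × κ → ℝ => ∑ p ∈ σ, X p)
      (expMatrixLaw A) := fun σ => integrable_finsetSum _ fun p _ => hc p
  have hm : Measurable fun X : ι × κ → ℝ => minAssign k X :=
    Measurable.iInf fun σ => Finset.measurable_sum _ fun p _ => measurable_pi_apply p
  refine Integrable.mono' (integrable_finsetSum Finset.univ fun p _ => (hc p).abs)
    hm.aestronglyMeasurable (Filter.Eventually.of_forall fun X => ?_)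
  have hb : ∀ σ : Finset (ι × κ), |∑ p ∈ σ, X p| ≤ ∑ p, |X p| := fun σ =>
    (Finset.abs_sum_le_sum_abs _ _).trans
      (Finset.sum_le_univ_sum_of_nonneg fun p => abs_nonneg _)
  rw [Real.norm_eq_abs, minAssign]
  rcases isEmpty_or_nonempty {σ : Finset (ι × κ) // IsAssignment k σ} with h | h
  · rw [Real.iInf_of_isEmpty, abs_zero]
    exact Finset.sum_nonneg fun p _ => abs_nonneg _
  · obtain ⟨σ, hσ⟩ := exists_eq_ciInf_of_finite
      (f := fun σ : {σ : Finset (ι × κ) // IsAssignment k σ} => ∑ p ∈ σ.1, X p)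
    rw [← hσ]
    exact hb σ.1

end

end MinAssign

/-! Split the matrix into a top block `T`, whose rates tend to 0, and a bottom block `B`, whose law
is fixed. An exponential of rate `a` has density at most `a`, so as the rates vanish the sums of `T`
over two distinct sets of positions differ, with probability tending to 1, by more than the sum of
all entries of `B` (`measure_closeCosts_le`). Comparison with the empty set shows that a matching
which can stay in the bottom block does so (`minAssign_glue_eq`). If `t = k - d > 0` top positions
are forced, the top part must be the optimal `t`-matching of `T`, and the bottom block supplies the
best completion in the columns left free (`minAssign_glue_sub_eq`). The difference `min_k - min_t`
always lies between 0 and the sum of `B`, so it can be averaged by dominated convergence although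
each of the two expectations diverges.

It remains to find the law of the column set of the optimal `t`-matching of `T`. For every choice of
positive row rates, not only in the limit, it is the urn law `Pr c` (`measureReal_optEvent`).
Indeed, optimal column sets of successive sizes are nested (`exists_cols_subset`), so they grow by
one column at a time. Suppose the column `j` is added to `K` with its entry in row `i`. Exchanging
the entries `(i, j)` and `(i, j')` for another unused column `j'` turns this event into the one
where `j'` is added in row `i`, and the event constrains `(i, j')` only by `X (i, j) ≤ X (i, j')`.
The two probabilities are therefore in the ratio of the rates, that is `c j : c j'` whatever `i` is
(`rate_mul_stepEvent`). So the next column is drawn with probability proportional to its weight. -/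

namespace MinAssign

/-! ### Exchange arguments for matchings and nesting of optimal column sets. -/

section Combinatorics

variable {ι κ : Type*} [DecidableEq ι] [DecidableEq κ]

/-- A set of positions, no two of which lie in the same row or in the same column. -/
def IsMatching {ι κ : Type*} (σ : Finset (ι × κ)) : Prop :=
  (∀ p ∈ σ, ∀ q ∈ σ, p.1 = q.1 → p = q) ∧ (∀ p ∈ σ, ∀ q ∈ σ, p.2 = q.2 → p = q)

/-- The set of rows that `σ` meets. -/
def rows {ι κ : Type*} [DecidableEq ι] (σ : Finset (ι × κ)) : Finset ι := σ.image Prod.fst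

/-- The set of columns that `σ` meets. -/
def cols {ι κ : Type*} [DecidableEq κ] (σ : Finset (ι × κ)) : Finset κ := σ.image Prod.snd

/-- The sum of the entries of `X` at the positions in `σ`. -/
def cost {ι κ : Type*} (X : ι × κ → ℝ) (σ : Finset (ι × κ)) : ℝ := ∑ p ∈ σ, X p

lemma mem_rows {ι κ : Type*} [DecidableEq ι] {σ : Finset (ι × κ)} {i : ι} :
    i ∈ rows σ ↔ ∃ j, (i, j) ∈ σ := by
  simp [rows]

lemma mem_cols {ι κ : Type*} [DecidableEq κ] {σ : Finset (ι × κ)} {j : κ} :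
    j ∈ cols σ ↔ ∃ i, (i, j) ∈ σ := by
  simp [cols]

lemma IsMatching.mono {ι κ : Type*} {σ τ : Finset (ι × κ)} (hτ : IsMatching τ) (h : σ ⊆ τ) :
    IsMatching σ :=
  ⟨fun p hp q hq => hτ.1 p (h hp) q (h hq), fun p hp q hq => hτ.2 p (h hp) q (h hq)⟩

lemma isMatching_empty {ι κ : Type*} : IsMatching (∅ : Finset (ι × κ)) := by
  simp [IsMatching]

lemma IsMatching.card_rows {ι κ : Type*} [DecidableEq ι] {σ : Finset (ι × κ)}
    (h : IsMatching σ) : (rows σ).card = σ.card :=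
  Finset.card_image_of_injOn fun p hp q hq => h.1 p hp q hq

lemma IsMatching.card_cols {ι κ : Type*} [DecidableEq κ] {σ : Finset (ι × κ)}
    (h : IsMatching σ) : (cols σ).card = σ.card :=
  Finset.card_image_of_injOn fun p hp q hq => h.2 p hp q hq

lemma IsMatching.rows_erase {σ : Finset (ι × κ)} (h : IsMatching σ) {p : ι × κ} (hp : p ∈ σ) :
    rows (σ.erase p) = (rows σ).erase p.1 := by
  ext i
  simp only [mem_rows, Finset.mem_erase]
  constructor
  · rintro ⟨j, h1, h2⟩
    exact ⟨fun e => h1 (h.1 _ h2 _ hp e), j, h2⟩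
  · rintro ⟨h1, j, h2⟩
    exact ⟨j, fun e => h1 (by rw [← e]), h2⟩

lemma IsMatching.cols_erase {σ : Finset (ι × κ)} (h : IsMatching σ) {p : ι × κ} (hp : p ∈ σ) :
    cols (σ.erase p) = (cols σ).erase p.2 := by
  ext i
  simp only [mem_cols, Finset.mem_erase]
  constructor
  · rintro ⟨j, h1, h2⟩
    exact ⟨fun e => h1 (h.2 _ h2 _ hp e), j, h2⟩
  · rintro ⟨h1, j, h2⟩
    exact ⟨j, fun e => h1 (by rw [← e]), h2⟩

lemma rows_insert (σ : Finset (ι × κ)) (p : ι × κ) : rows (insert p σ) = insert p.1 (rows σ) :=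
  Finset.image_insert _ _ _

lemma cols_insert (σ : Finset (ι × κ)) (p : ι × κ) : cols (insert p σ) = insert p.2 (cols σ) :=
  Finset.image_insert _ _ _

lemma IsMatching.insert {σ : Finset (ι × κ)} (h : IsMatching σ) {p : ι × κ} (h1 : p.1 ∉ rows σ)
    (h2 : p.2 ∉ cols σ) : IsMatching (insert p σ) := by
  have h1' : ∀ q ∈ σ, q.1 ≠ p.1 := fun q hq e => h1 (mem_rows.2 ⟨q.2, by rw [← e]; exact hq⟩)
  have h2' : ∀ q ∈ σ, q.2 ≠ p.2 := fun q hq e => h2 (mem_cols.2 ⟨q.1, by rw [← e]; exact hq⟩)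
  constructor
  · intro q hq q' hq' e
    rcases Finset.mem_insert.1 hq with rfl | hm <;> rcases Finset.mem_insert.1 hq' with rfl | hm'
    · rfl
    · exact absurd e.symm (h1' _ hm')
    · exact absurd e (h1' _ hm)
    · exact h.1 _ hm _ hm' e
  · intro q hq q' hq' e
    rcases Finset.mem_insert.1 hq with rfl | hm <;> rcases Finset.mem_insert.1 hq' with rfl | hm'
    · rfl
    · exact absurd e.symm (h2' _ hm')
    · exact absurd e (h2' _ hm)
    · exact h.2 _ hm _ hm' e

lemma cost_insert (X : ι × κ → ℝ) {σ : Finset (ι × κ)} {p : ι × κ} (h : p.1 ∉ rows σ) :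
    cost X (insert p σ) = X p + cost X σ :=
  Finset.sum_insert fun hp => h (mem_rows.2 ⟨p.2, hp⟩)

lemma cost_erase (X : ι × κ → ℝ) {σ : Finset (ι × κ)} {p : ι × κ} (h : p ∈ σ) :
    X p + cost X (σ.erase p) = cost X σ :=
  Finset.add_sum_erase _ _ h

/-- Exchange of a column between two matchings: if column `j'` belongs to `τ` but not to `σ`, and
`σ` is at least as large as `τ`, then `j'` can be traded for some column `j` of `σ`. -/
lemma exists_exchange (X : ι × κ → ℝ) {σ τ : Finset (ι × κ)} (hσ : IsMatching σ)
    (hτ : IsMatching τ) (hcard : τ.card ≤ σ.card) {j' : κ} (hj'τ : j' ∈ cols τ)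
    (hj'σ : j' ∉ cols σ) :
    ∃ j ∈ cols σ, j ∉ cols τ ∧ ∃ σ' τ' : Finset (ι × κ), IsMatching σ' ∧ IsMatching τ' ∧
      cols σ' = insert j' ((cols σ).erase j) ∧ cols τ' = insert j ((cols τ).erase j') ∧
      rows σ' ⊆ rows σ ∪ rows τ ∧ rows τ' ⊆ rows σ ∪ rows τ ∧
      cost X σ' + cost X τ' = cost X σ + cost X τ := by
  induction hn : τ.card generalizing σ τ j' with
  | zero => simp [Finset.card_eq_zero.1 hn, cols] at hj'τ
  | succ n ih =>
  obtain ⟨i, hp⟩ := mem_cols.1 hj'τ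
  -- Row `i` must be free in `σ` before `(i, j')` can enter. Either `σ` already uses row `i`, and
  -- that position leaves (`i₂ = i`), or, since `σ` is at least as large as `τ`, some row `i₂` of
  -- `σ` is unused by `τ`, and the position in it can pass to `τ`.
  obtain ⟨i₂, j₁, hq, hiσ, hi₂τ⟩ : ∃ i₂ j₁, (i₂, j₁) ∈ σ ∧ (i ∉ (rows σ).erase i₂) ∧
      i₂ ∉ (rows τ).erase i := by
    by_cases hi : i ∈ rows σ
    · obtain ⟨j₁, hj₁⟩ := mem_rows.1 hi
      exact ⟨i, j₁, hj₁, by simp, by simp⟩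
    · have hi' : i ∈ rows τ := mem_rows.2 ⟨j', hp⟩
      obtain ⟨i₂, h1, h2⟩ : ∃ i₂ ∈ rows σ, i₂ ∉ rows τ := by
        by_contra! hcon
        have : rows σ ⊂ rows τ := Finset.ssubset_iff_subset_ne.2 ⟨hcon, fun e => hi (e ▸ hi')⟩
        have := Finset.card_lt_card this
        rw [hσ.card_rows, hτ.card_rows] at this
        omega
      obtain ⟨j₁, hj₁⟩ := mem_rows.1 h1
      exact ⟨i₂, j₁, hj₁, by simp [hi], by simp [h2]⟩
  have hj₁σ : j₁ ∈ cols σ := mem_cols.2 ⟨i₂, hq⟩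
  have hne : j₁ ≠ j' := fun e => hj'σ (e ▸ hj₁σ)
  have hi₂σ : i₂ ∈ rows σ := mem_rows.2 ⟨j₁, hq⟩
  have hiτ : i ∈ rows τ := mem_rows.2 ⟨j', hp⟩
  set σ₀ := σ.erase (i₂, j₁) with hσ₀
  set τ₀ := τ.erase (i, j') with hτ₀
  have mσ₀ : IsMatching σ₀ := hσ.mono (Finset.erase_subset _ _)
  have mτ₀ : IsMatching τ₀ := hτ.mono (Finset.erase_subset _ _)
  have rσ₀ : rows σ₀ = (rows σ).erase i₂ := hσ.rows_erase hq
  have rτ₀ : rows τ₀ = (rows τ).erase i := hτ.rows_erase hp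
  have cσ₀ : cols σ₀ = (cols σ).erase j₁ := hσ.cols_erase hq
  have cτ₀ : cols τ₀ = (cols τ).erase j' := hτ.cols_erase hp
  have kσ := cost_erase X hq
  have kτ := cost_erase X hp
  -- If `τ` already has column `j₁`, the same problem recurs for the smaller matchings `σ₀`, `τ₀`
  -- with `j₁` in the role of `j'`: an alternating path is followed. The row clauses of the
  -- conclusion serve this induction, as they keep `i` and `i₂` free for the two insertions.
  by_cases hj₁ : j₁ ∈ cols τ
  · have hcσ : σ₀.card + 1 = σ.card := Finset.card_erase_add_one hq
    have hcτ : τ₀.card + 1 = τ.card := Finset.card_erase_add_one hp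
    obtain ⟨j, hjσ, hjτ, σ', τ', mσ', mτ', cσ', cτ', rσ', rτ', hk⟩ := ih mσ₀ mτ₀ (by omega)
      (j' := j₁) (by simp [cτ₀, hne, hj₁]) (by simp [cσ₀]) (by omega)
    have hsub : rows σ₀ ∪ rows τ₀ ⊆ rows σ ∪ rows τ := by
      rw [rσ₀, rτ₀]
      exact Finset.union_subset_union (Finset.erase_subset _ _) (Finset.erase_subset _ _)
    have hi : i ∉ rows σ' := fun h => by
      have := rσ' h
      rw [rσ₀, rτ₀] at this
      simp only [Finset.mem_union, Finset.mem_erase] at this hiσ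
      tauto
    have hi₂ : i₂ ∉ rows τ' := fun h => by
      have := rτ' h
      rw [rσ₀, rτ₀] at this
      simp only [Finset.mem_union, Finset.mem_erase] at this hi₂τ
      tauto
    rw [cσ₀] at hjσ cσ'
    rw [cτ₀] at hjτ cτ'
    have hjσ2 : j ∈ cols σ := Finset.mem_of_mem_erase hjσ
    have hjj₁ : j ≠ j₁ := Finset.ne_of_mem_erase hjσ
    have hjj' : j ≠ j' := fun e => hj'σ (e ▸ hjσ2)
    have hjτ2 : j ∉ cols τ := fun h => hjτ (Finset.mem_erase.2 ⟨hjj', h⟩)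
    refine ⟨j, hjσ2, hjτ2, insert (i, j') σ', insert (i₂, j₁) τ', mσ'.insert hi ?_,
      mτ'.insert hi₂ ?_, ?_, ?_, ?_, ?_, ?_⟩
    · rw [cσ']; simp [hne.symm, hj'σ]
    · rw [cτ']; simp [hjj₁.symm]
    · rw [cols_insert, cσ']; ext x; simp; grind
    · rw [cols_insert, cτ']; ext x; simp; grind
    · rw [rows_insert]
      exact Finset.insert_subset (by simp [hiτ]) (rσ'.trans hsub)
    · rw [rows_insert]
      exact Finset.insert_subset (by simp [hi₂σ]) (rτ'.trans hsub)
    · rw [cost_insert X hi, cost_insert X hi₂]; linarith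
  · have hi : i ∉ rows σ₀ := by rw [rσ₀]; exact hiσ
    have hi₂ : i₂ ∉ rows τ₀ := by rw [rτ₀]; exact hi₂τ
    refine ⟨j₁, hj₁σ, hj₁, insert (i, j') σ₀, insert (i₂, j₁) τ₀, mσ₀.insert hi ?_,
      mτ₀.insert hi₂ ?_, ?_, ?_, ?_, ?_, ?_⟩
    · rw [cσ₀]; simp [hj'σ]
    · rw [cτ₀]; simp [hj₁]
    · rw [cols_insert, cσ₀]
    · rw [cols_insert, cτ₀]
    · rw [rows_insert, rσ₀]
      exact Finset.insert_subset (by simp [hiτ])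
        ((Finset.erase_subset _ _).trans Finset.subset_union_left)
    · rw [rows_insert, rτ₀]
      exact Finset.insert_subset (by simp [hi₂σ])
        ((Finset.erase_subset _ _).trans Finset.subset_union_right)
    · rw [cost_insert X hi, cost_insert X hi₂]; linarith

/-- If `σ` is no worse than any matching of its size with at most one column outside those of
`σ`, then every matching that is at least as large can be replaced by one that meets all columns
of `σ`. -/
lemma exists_cols_subset (X : ι × κ → ℝ) {σ τ : Finset (ι × κ)} (hσ : IsMatching σ)
    (hopt : ∀ ρ : Finset (ι × κ), IsMatching ρ → ρ.card = σ.card → (cols ρ \ cols σ).card ≤ 1 →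
      cost X σ ≤ cost X ρ)
    (hτ : IsMatching τ) (hcard : σ.card ≤ τ.card) :
    ∃ τ' : Finset (ι × κ), IsMatching τ' ∧ τ'.card = τ.card ∧ cost X τ' ≤ cost X τ ∧
      cols σ ⊆ cols τ' := by
  induction hn : (cols σ \ cols τ).card generalizing τ with
  | zero =>
    rw [Finset.card_eq_zero, Finset.sdiff_eq_empty_iff_subset] at hn
    exact ⟨τ, hτ, rfl, le_rfl, hn⟩
  | succ n ih =>
    obtain ⟨j, hj⟩ : (cols σ \ cols τ).Nonempty := Finset.card_pos.1 (by omega)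
    rw [Finset.mem_sdiff] at hj
    obtain ⟨j', hj'τ, hj'σ, τ', σ', mτ', mσ', cτ', cσ', -, -, hk⟩ :=
      exists_exchange X hτ hσ hcard hj.1 hj.2
    have hcσ' : σ'.card = σ.card := by
      rw [← mσ'.card_cols, ← hσ.card_cols, cσ', Finset.card_insert_of_notMem (by simp [hj'σ]),
        Finset.card_erase_add_one hj.1]
    have hcτ' : τ'.card = τ.card := by
      rw [← mτ'.card_cols, ← hτ.card_cols, cτ', Finset.card_insert_of_notMem (by simp [hj.2]),
        Finset.card_erase_add_one hj'τ]
    -- The only new column of `σ'` is `j'`, so `hopt` applies. As `σ` does not lose against `σ'` and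
    -- the total cost is preserved, `τ'` costs at most as much as `τ`.
    have h1 := hopt σ' mσ' hcσ' (by
      rw [cσ']
      refine (Finset.card_le_card (t := {j'}) fun x => ?_).trans (by simp)
      simp; grind)
    obtain ⟨ρ, h2, h3, h4, h5⟩ := ih mτ' (by omega) (by
      have : cols σ \ cols τ' = (cols σ \ cols τ).erase j := by
        rw [cτ']; ext x; simp; grind
      rw [this, Finset.card_erase_of_mem (by simp [hj]), hn]; rfl)
    exact ⟨ρ, h2, h3.trans hcτ', by linarith, h5⟩

end Combinatorics

/-! ### Exponential variables: exchange of two entries, and improbability of near ties. -/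

section Exponential

open scoped ENNReal

/-- Redrawing one coordinate independently from its own law does not change a product measure. -/
lemma lintegral_pi_update {P : Type*} [Fintype P] [DecidableEq P] (μ : P → Measure ℝ)
    [∀ p, IsProbabilityMeasure (μ p)] {f : (P → ℝ) → ℝ≥0∞} (hf : Measurable f) (p : P) :
    ∫⁻ X, f X ∂Measure.pi μ =
      ∫⁻ X, ∫⁻ t, f (Function.update X p t) ∂μ p ∂Measure.pi μ := by
  refine lintegral_eq_of_lmarginal_eq {p} hf ?_ ?_
  · have : Measurable fun z : (P → ℝ) × ℝ => f (Function.update z.1 p z.2) :=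
      hf.comp (measurable_update' (a := p))
    exact this.lintegral_prod_right'
  · ext x
    simp [lmarginal_singleton]

lemma expMeasure_eq (a : ℝ) : expMeasure a = volume.withDensity (exponentialPDF a) := rfl

lemma measurable_exponentialPDF (a : ℝ) : Measurable (exponentialPDF a) :=
  (measurable_exponentialPDFReal a).ennreal_ofReal

lemma lintegral_expMeasure (a : ℝ) {g : ℝ → ℝ≥0∞} (hg : Measurable g) :
    ∫⁻ s, g s ∂expMeasure a = ∫⁻ s, exponentialPDF a s * g s := by
  rw [expMeasure_eq, lintegral_withDensity_eq_lintegral_mul _ (measurable_exponentialPDF a) hg]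
  rfl

lemma expMeasure_Icc_le {a : ℝ} (ha : 0 < a) (x y : ℝ) :
    expMeasure a (Set.Icc x y) ≤ ENNReal.ofReal (a * (y - x)) := by
  rw [expMeasure_eq, withDensity_apply _ measurableSet_Icc, ENNReal.ofReal_mul ha.le,
    ← Real.volume_Icc, ← setLIntegral_const]
  refine lintegral_mono fun t => ?_
  rw [exponentialPDF_eq]
  refine ENNReal.ofReal_le_ofReal ?_
  split_ifs with h
  · have : Real.exp (-(a * t)) ≤ 1 := Real.exp_le_one_iff.2 (by nlinarith)
    nlinarith
  · exact ha.le

lemma ae_nonneg_expMeasure (a : ℝ) : ∀ᵐ x ∂expMeasure a, 0 ≤ x := by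
  rw [ae_iff]
  have : {x : ℝ | ¬ 0 ≤ x} = Set.Iio 0 := by ext; simp
  rw [this, expMeasure_eq, withDensity_apply _ measurableSet_Iio,
    lintegral_exponentialPDF_of_nonpos le_rfl]

lemma expMeasure_Ici {a : ℝ} (ha : 0 < a) {x : ℝ} (hx : 0 ≤ x) :
    expMeasure a (Set.Ici x) = ENNReal.ofReal (Real.exp (-(a * x))) := by
  have := isProbabilityMeasure_expMeasure ha
  have h0 : expMeasure a {x} = 0 := le_antisymm (by simpa using expMeasure_Icc_le ha x x) zero_le
  have h1 : expMeasure a (Set.Iic x) = ENNReal.ofReal (1 - Real.exp (-(a * x))) := by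
    rw [← ofReal_cdf, cdf_expMeasure_eq ha, if_pos hx]
  have h2 : expMeasure a (Set.Ici x) = expMeasure a (Set.Ioi x) := by
    refine le_antisymm ?_ (measure_mono Set.Ioi_subset_Ici_self)
    rw [← Set.Ioi_insert, Set.insert_eq]
    exact (measure_union_le _ _).trans (by simp [h0])
  rw [h2, ← Set.compl_Iic, prob_compl_eq_one_sub measurableSet_Iic, h1,
    ← ENNReal.ofReal_one, ← ENNReal.ofReal_sub _ (by simpa using by positivity)]
  simp

/-- Two independent exponential variables of rates `a` and `b`: the minimum is independent of
which of the two attains it. -/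
lemma lintegral_mul_expMeasure_Ici {a b : ℝ} (ha : 0 < a) (hb : 0 < b) {h : ℝ → ℝ≥0∞}
    (hh : Measurable h) :
    ENNReal.ofReal b * ∫⁻ s, h s * expMeasure b (Set.Ici s) ∂expMeasure a =
      ENNReal.ofReal a * ∫⁻ s, h s * expMeasure a (Set.Ici s) ∂expMeasure b := by
  have := isProbabilityMeasure_expMeasure ha
  have := isProbabilityMeasure_expMeasure hb
  have hm : ∀ c : ℝ, Measurable fun s => expMeasure c (Set.Ici s) := fun c =>
    Antitone.measurable fun s t hst => measure_mono (Set.Ici_subset_Ici.2 hst)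
  have hg : ∀ c : ℝ, Measurable fun s => h s * expMeasure c (Set.Ici s) := fun c => hh.mul (hm c)
  rw [lintegral_expMeasure a (hg b), lintegral_expMeasure b (hg a),
    ← lintegral_const_mul _ ((measurable_exponentialPDF a).fun_mul (hg b)),
    ← lintegral_const_mul _ ((measurable_exponentialPDF b).fun_mul (hg a))]
  -- For `s ≥ 0` both integrands equal `a * b * exp (-(a + b) * s) * h s`.
  congr 1 with s
  rcases lt_or_ge s 0 with hs | hs
  · simp [exponentialPDF_of_neg hs]
  · rw [exponentialPDF_of_nonneg hs, exponentialPDF_of_nonneg hs, expMeasure_Ici ha hs,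
      expMeasure_Ici hb hs, ENNReal.ofReal_mul ha.le, ENNReal.ofReal_mul hb.le]
    ring

/-- If the event `F` forces `X p ≤ X q` and otherwise does not depend on `X q`, and `G` is its
image under exchanging `X p` and `X q`, then the probabilities of `F` and `G` are proportional to
the rates of `X p` and `X q`. -/
lemma rate_mul_measure_eq {P : Type*} [Fintype P] [DecidableEq P] {A : P → ℝ} (hA : ∀ p, 0 < A p)
    {p q : P} (hpq : p ≠ q) {F G : Set (P → ℝ)} (hF : MeasurableSet F) (hG : MeasurableSet G)
    (hle : ∀ X ∈ F, X p ≤ X q)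
    (hup : ∀ X ∈ F, ∀ t, X p ≤ t → Function.update X q t ∈ F)
    (hsw : ∀ X, X ∘ Equiv.swap p q ∈ F ↔ X ∈ G) :
    ENNReal.ofReal (A q) * Measure.pi (fun p => expMeasure (A p)) F =
      ENNReal.ofReal (A p) * Measure.pi (fun p => expMeasure (A p)) G := by
  have := fun p => isProbabilityMeasure_expMeasure (hA p)
  set U : (P → ℝ) → ℝ → ℝ → P → ℝ := fun X s t => Function.update (Function.update X p s) q t
    with hU
  -- With the other coordinates frozen, membership in `F` is the condition `s ≤ t` together with a
  -- condition on `s` alone, read off by lowering `t` to `s`. For `G` the roles of `s` and `t` are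
  -- exchanged.
  have hUF : ∀ X s t, U X s t ∈ F ↔ s ≤ t ∧ U X s s ∈ F := fun X s t => by
    constructor
    · intro h
      have h1 := hle _ h
      simp [hU, hpq] at h1
      have h2 := hup _ h s (by simp [hU, hpq])
      simp only [hU, Function.update_idem] at h2
      exact ⟨h1, h2⟩
    · rintro ⟨h1, h2⟩
      have h3 := hup _ h2 t (by simpa [hU, hpq] using h1)
      simpa only [hU, Function.update_idem] using h3
  have hUG : ∀ X s t, U X s t ∈ G ↔ t ≤ s ∧ U X t t ∈ F := fun X s t => by
    rw [← hUF, ← hsw]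
    have : U X s t ∘ Equiv.swap p q = U X t s := by
      ext x
      by_cases hx : x = p
      · subst hx; simp [hU, hpq]
      · by_cases hx' : x = q
        · subst hx'; simp [hU, hpq]
        · simp [hU, hx, hx', Equiv.swap_apply_of_ne_of_ne]
    rw [this]
  have hUm : ∀ X, MeasurableSet {s | U X s s ∈ F} := fun X => by
    refine hF.preimage (measurable_pi_iff.2 fun x => ?_)
    simp only [hU, Function.update_apply]
    split_ifs <;> fun_prop
  have key : ∀ X,
      ENNReal.ofReal (A q) * ∫⁻ s, ∫⁻ t, F.indicator 1 (U X s t) ∂expMeasure (A q)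
        ∂expMeasure (A p) =
      ENNReal.ofReal (A p) * ∫⁻ t, ∫⁻ s, G.indicator 1 (U X s t) ∂expMeasure (A p)
        ∂expMeasure (A q) := fun X => by
    have h1 : ∀ s, ∫⁻ t, F.indicator 1 (U X s t) ∂expMeasure (A q) =
        {s | U X s s ∈ F}.indicator 1 s * expMeasure (A q) (Set.Ici s) := fun s => by
      rw [← lintegral_indicator_one measurableSet_Ici,
        ← lintegral_const_mul _ (measurable_one.indicator measurableSet_Ici)]
      congr 1 with t
      have := hUF X s t
      by_cases h1 : U X s s ∈ F <;> by_cases h2 : s ≤ t <;> simp [h1, h2, this]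
    have h2 : ∀ t, ∫⁻ s, G.indicator 1 (U X s t) ∂expMeasure (A p) =
        {s | U X s s ∈ F}.indicator 1 t * expMeasure (A p) (Set.Ici t) := fun t => by
      rw [← lintegral_indicator_one measurableSet_Ici,
        ← lintegral_const_mul _ (measurable_one.indicator measurableSet_Ici)]
      congr 1 with s
      have := hUG X s t
      by_cases h1 : U X t t ∈ F <;> by_cases h2 : t ≤ s <;> simp [h1, h2, this]
    simp_rw [h1, h2]
    exact lintegral_mul_expMeasure_Ici (hA p) (hA q) (measurable_one.indicator (hUm X))
  have hm : ∀ (S : Set (P → ℝ)) (_ : MeasurableSet S) (x y : P), x ≠ y →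
      Measure.pi (fun p => expMeasure (A p)) S = ∫⁻ X, ∫⁻ s, ∫⁻ t, S.indicator 1
        (Function.update (Function.update X x s) y t) ∂expMeasure (A y) ∂expMeasure (A x)
        ∂Measure.pi (fun p => expMeasure (A p)) ∧
      Measurable fun X => ∫⁻ s, ∫⁻ t, S.indicator (1 : (P → ℝ) → ℝ≥0∞)
        (Function.update (Function.update X x s) y t) ∂expMeasure (A y) ∂expMeasure (A x) := by
    intro S hS x y hxy
    have h1 : Measurable (S.indicator (1 : (P → ℝ) → ℝ≥0∞)) := measurable_one.indicator hS
    have h2 : Measurable fun X => ∫⁻ t, S.indicator (1 : (P → ℝ) → ℝ≥0∞)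
        (Function.update X y t) ∂expMeasure (A y) :=
      (h1.comp (measurable_update' (a := y))).lintegral_prod_right'
    have h3 : Measurable fun X => ∫⁻ s, ∫⁻ t, S.indicator (1 : (P → ℝ) → ℝ≥0∞)
        (Function.update (Function.update X x s) y t) ∂expMeasure (A y) ∂expMeasure (A x) :=
      (h2.comp (measurable_update' (a := x))).lintegral_prod_right'
    refine ⟨?_, h3⟩
    rw [← lintegral_indicator_one hS, lintegral_pi_update _ h1 y, lintegral_pi_update _ h2 x]
  obtain ⟨e1, m1⟩ := hm F hF p q hpq
  obtain ⟨e2, m2⟩ := hm G hG q p hpq.symm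
  rw [e1, e2, ← lintegral_const_mul _ m1, ← lintegral_const_mul _ m2]
  congr 1 with X
  rw [key X]
  simp only [hU, Function.update_comm hpq]

/-- The sums of the entries of a random exponential matrix over two distinct sets are unlikely to
be close when the rates are small. -/
lemma measure_abs_cost_sub_le {ι κ : Type*} [Fintype ι] [Fintype κ] {A : ι × κ → ℝ}
    (hA : ∀ p, 0 < A p) (b : ℝ) {σ τ : Finset (ι × κ)} (hστ : σ ≠ τ) :
    expMatrixLaw A {X | |cost X σ - cost X τ| ≤ b} ≤ ENNReal.ofReal (2 * b * ∑ p, A p) := by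
  classical
  have := fun p => isProbabilityMeasure_expMeasure (hA p)
  have main : ∀ σ τ : Finset (ι × κ), ∀ p ∈ σ, p ∉ τ →
      expMatrixLaw A {X | |cost X σ - cost X τ| ≤ b} ≤ ENNReal.ofReal (2 * b * ∑ p, A p) := by
    intro σ τ p hpσ hpτ
    have hm : MeasurableSet {X : ι × κ → ℝ | |cost X σ - cost X τ| ≤ b} := by
      unfold cost
      measurability
    rw [expMatrixLaw, ← lintegral_indicator_one hm,
      lintegral_pi_update _ (measurable_one.indicator hm) p]
    refine (lintegral_mono (g := fun _ => ENNReal.ofReal (2 * b * ∑ p, A p)) fun X => ?_).trans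
      (by simp)
    -- Given all entries but `p`, the difference of the costs is `t - z`, so `t` is confined to an
    -- interval of length `2 * b`.
    set z := cost X τ - cost X (σ.erase p)
    have hsub : ∀ t, |cost (Function.update X p t) σ - cost (Function.update X p t) τ| ≤ b →
        t ∈ Set.Icc (z - b) (z + b) := fun t ht => by
      have h1 : cost (Function.update X p t) σ = t + cost X (σ.erase p) := by
        rw [cost, ← Finset.add_sum_erase _ _ hpσ, Function.update_self, cost]
        congr 1
        exact Finset.sum_congr rfl fun q hq => by
          rw [Function.update_of_ne (Finset.ne_of_mem_erase hq)]
      have h2 : cost (Function.update X p t) τ = cost X τ :=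
        Finset.sum_congr rfl fun q hq => by
          rw [Function.update_of_ne (ne_of_mem_of_not_mem hq hpτ)]
      rw [h1, h2, abs_le] at ht
      constructor <;> simp only [z] <;> linarith
    rcases lt_or_ge b 0 with hb | hb
    · refine le_of_eq_of_le ?_ zero_le
      rw [lintegral_eq_zero_iff']
      · refine Filter.Eventually.of_forall fun t => ?_
        refine Set.indicator_of_notMem (fun h => ?_) _
        have := hsub t h
        linarith [this.1, this.2]
      · exact ((measurable_one.indicator hm).comp
          (measurable_update X)).aemeasurable
    calc _ ≤ ∫⁻ t, (Set.Icc (z - b) (z + b)).indicator 1 t ∂expMeasure (A p) := by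
          refine lintegral_mono fun t => ?_
          by_cases h : Function.update X p t ∈ {X | |cost X σ - cost X τ| ≤ b}
          · simp only [Set.indicator_of_mem h, Set.indicator_of_mem (hsub t h)]; exact le_rfl
          · simp [Set.indicator_of_notMem h]
      _ = expMeasure (A p) (Set.Icc (z - b) (z + b)) := lintegral_indicator_one measurableSet_Icc
      _ ≤ ENNReal.ofReal (A p * ((z + b) - (z - b))) := expMeasure_Icc_le (hA p) _ _
      _ ≤ _ := by
        refine ENNReal.ofReal_le_ofReal ?_
        have := Finset.single_le_sum (fun q _ => (hA q).le) (Finset.mem_univ p)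
        nlinarith
  obtain ⟨p, hp⟩ : ∃ p, ¬ (p ∈ σ ↔ p ∈ τ) := by
    by_contra! h
    exact hστ (Finset.ext h)
  by_cases h : p ∈ σ
  · exact main σ τ p h (by tauto)
  · simp_rw [abs_sub_comm (cost _ σ)]
    exact main τ σ p (by tauto) h

/-- The matrices for which two distinct sets of positions have sums of entries at most `b`
apart. -/
def closeCosts (ι κ : Type*) (b : ℝ) : Set (ι × κ → ℝ) :=
  {X | ∃ σ τ : Finset (ι × κ), σ ≠ τ ∧ |cost X σ - cost X τ| ≤ b}

lemma closeCosts_eq_iUnion (ι κ : Type*) (b : ℝ) : closeCosts ι κ b =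
    ⋃ (σ : Finset (ι × κ)) (τ : Finset (ι × κ)) (_ : σ ≠ τ), {X | |cost X σ - cost X τ| ≤ b} := by
  ext X
  simp [closeCosts]

lemma measurable_cost {ι κ : Type*} (σ : Finset (ι × κ)) :
    Measurable fun X : ι × κ → ℝ => cost X σ :=
  Finset.measurable_sum _ fun p _ => measurable_pi_apply p

lemma measurableSet_closeCosts (ι κ : Type*) [Fintype ι] [Fintype κ] (b : ℝ) :
    MeasurableSet (closeCosts ι κ b) := by
  rw [closeCosts_eq_iUnion]
  refine MeasurableSet.iUnion fun σ => MeasurableSet.iUnion fun τ => MeasurableSet.iUnion fun _ =>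
    measurableSet_le ((measurable_cost σ).sub (measurable_cost τ)).abs measurable_const

lemma measure_closeCosts_le {ι κ : Type*} [Fintype ι] [Fintype κ] {A : ι × κ → ℝ}
    (hA : ∀ p, 0 < A p) (b : ℝ) :
    expMatrixLaw A (closeCosts ι κ b) ≤
      (Fintype.card (Finset (ι × κ)) : ℝ≥0∞) ^ 2 * ENNReal.ofReal (2 * b * ∑ p, A p) := by
  classical
  rw [closeCosts_eq_iUnion]
  refine (measure_iUnion_fintype_le _ _).trans ?_
  refine (Finset.sum_le_sum fun σ _ => measure_iUnion_fintype_le _ _).trans ?_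
  refine (Finset.sum_le_sum (g := fun _ => ∑ τ : Finset (ι × κ),
    ENNReal.ofReal (2 * b * ∑ p, A p)) fun σ _ => Finset.sum_le_sum fun τ _ => ?_).trans ?_
  · by_cases h : σ = τ
    · simp [h]
    · simpa [h] using measure_abs_cost_sub_le hA b h
  · simp [pow_two, mul_assoc]

/-- Almost surely there are no ties, so optimal matchings of each size are unique. -/
lemma measure_closeCosts_zero {ι κ : Type*} [Fintype ι] [Fintype κ] {A : ι × κ → ℝ}
    (hA : ∀ p, 0 < A p) : expMatrixLaw A (closeCosts ι κ 0) = 0 :=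
  le_antisymm ((measure_closeCosts_le hA 0).trans (by simp)) zero_le

end Exponential

/-! ### The urn: recursion on the last draw. -/

section Urn

variable {κ : Type*} [Fintype κ] [DecidableEq κ]

lemma injective_of_card_image {κ : Type*} [DecidableEq κ] {t : ℕ} {x : Fin t → κ}
    (h : (Finset.univ.image x).card = t) : Function.Injective x := by
  have : Set.InjOn x (Finset.univ : Finset (Fin t)) := Finset.card_image_iff.1 (by simpa using h)
  simpa [Set.injOn_univ] using this

/-- A function on `Fin t` whose image has `t` elements is injective, so bijections onto `K` can be
replaced by arbitrary functions with image `K`. From these the last value can be split off by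
`Fin.snoc`. -/
lemma Pr_eq_sum (w : κ → ℝ) {t : ℕ} {K : Finset κ} (hK : K.card = t) :
    Pr w K = ∑ x : Fin t → κ, if Finset.univ.image x = K then drawProb w x else 0 := by
  subst hK
  rw [Pr, ← Finset.sum_filter]
  refine Finset.sum_bij (fun π _ i => (π i : κ)) ?_ ?_ ?_ ?_
  · intro π _
    simp only [Finset.mem_filter, Finset.mem_univ, true_and]
    ext a
    simp only [Finset.mem_image, Finset.mem_univ, true_and]
    exact ⟨fun ⟨i, hi⟩ => hi ▸ (π i).2, fun ha => ⟨π.symm ⟨a, ha⟩, by simp⟩⟩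
  · intro π _ π' _ h
    ext i
    exact congrFun h i
  · intro x hx
    simp only [Finset.mem_filter, Finset.mem_univ, true_and] at hx
    have hmem : ∀ i, x i ∈ K := fun i => hx ▸ Finset.mem_image_of_mem x (Finset.mem_univ i)
    have hinj : Function.Injective x := injective_of_card_image (by rw [hx])
    refine ⟨Equiv.ofBijective (fun i => ⟨x i, hmem i⟩) ⟨fun a b h => hinj (Subtype.ext_iff.1 h),
      fun ⟨a, ha⟩ => ?_⟩, Finset.mem_univ _, rfl⟩
    rw [← hx] at ha
    obtain ⟨i, -, hi⟩ := Finset.mem_image.1 ha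
    exact ⟨i, Subtype.ext hi⟩
  · intro π _
    rfl

lemma drawProb_snoc {κ : Type*} [Fintype κ] (w : κ → ℝ) {t : ℕ} (y : Fin t → κ) (j : κ) :
    drawProb w (Fin.snoc y j : Fin (t + 1) → κ) =
      drawProb w y * (w j / (∑ a, w a - ∑ i, w (y i))) := by
  rw [drawProb, Fin.prod_univ_castSucc, drawProb]
  simp only [Finset.sum_filter, Fin.sum_univ_castSucc, Fin.snoc_castSucc, Fin.snoc_last,
    Fin.castSucc_lt_castSucc_iff, Fin.castSucc_lt_last, if_true, lt_irrefl, if_false, add_zero]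
  simp [(Fin.castSucc_lt_last _).not_gt]

/-- Recursion for `Pr`, according to the last ball drawn. -/
lemma Pr_eq_sum_erase (w : κ → ℝ) {K : Finset κ} (hK : K.Nonempty) :
    Pr w K = ∑ j ∈ K, Pr w (K.erase j) * (w j / (∑ a, w a - ∑ a ∈ K.erase j, w a)) := by
  obtain ⟨t, ht⟩ : ∃ t, K.card = t + 1 := ⟨K.card - 1, by have := hK.card_pos; omega⟩
  have hiff : ∀ (y : Fin t → κ) (j : κ),
      Finset.univ.image (Fin.snoc y j : Fin (t + 1) → κ) = K ↔
        j ∈ K ∧ Finset.univ.image y = K.erase j := fun y j => by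
    have h1 : Finset.univ.image (Fin.snoc y j : Fin (t + 1) → κ) =
        insert j (Finset.univ.image y) := by
      ext a
      simp only [Finset.mem_image, Finset.mem_univ, true_and, Finset.mem_insert]
      rw [Fin.exists_fin_succ']
      simp [eq_comm, or_comm]
    rw [h1]
    constructor
    · rintro rfl
      refine ⟨Finset.mem_insert_self _ _, ?_⟩
      rw [Finset.erase_insert]
      intro hj
      rw [Finset.insert_eq_of_mem hj] at ht
      have : (Finset.univ.image y).card ≤ t := Finset.card_image_le.trans (by simp)
      omega
    · rintro ⟨h2, h3⟩
      rw [h3, Finset.insert_erase h2]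
  rw [Pr_eq_sum w ht, ← (Fin.snocEquiv fun _ : Fin (t + 1) => κ).sum_comp, Fintype.sum_prod_type,
    ← Finset.sum_filter_add_sum_filter_not Finset.univ (· ∈ K)]
  simp only [Fin.snocEquiv, Equiv.coe_fn_mk, hiff, drawProb_snoc]
  rw [Finset.sum_eq_zero (s := Finset.univ.filter (· ∉ K)), add_zero]
  · rw [Finset.filter_mem_eq_inter, Finset.univ_inter]
    refine Finset.sum_congr rfl fun j hj => ?_
    rw [Pr_eq_sum w (t := t) (by rw [Finset.card_erase_of_mem hj, ht]; rfl), Finset.sum_mul]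
    refine Finset.sum_congr rfl fun y _ => ?_
    by_cases h : Finset.univ.image y = K.erase j
    · have hinj : Function.Injective y :=
        injective_of_card_image (by rw [h, Finset.card_erase_of_mem hj, ht]; rfl)
      rw [if_pos ⟨hj, h⟩, if_pos h, ← h, Finset.sum_image hinj.injOn]
    · rw [if_neg (by tauto), if_neg h, zero_mul]
  · intro j hj
    refine Finset.sum_eq_zero fun y _ => if_neg ?_
    simp only [Finset.mem_filter] at hj
    tauto

lemma Pr_empty (w : κ → ℝ) : Pr w ∅ = 1 := by
  rw [Pr_eq_sum w Finset.card_empty]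
  simp [drawProb]

end Urn

/-! ### The column set of the optimal matching follows the urn law. -/

section OptimalColumns

variable {ι κ : Type*} [DecidableEq ι] [DecidableEq κ]

lemma exists_isMatching_card {ι κ : Type*} [Fintype ι] [Fintype κ] {t : ℕ}
    (hι : t ≤ Fintype.card ι) (hκ : t ≤ Fintype.card κ) :
    ∃ σ : Finset (ι × κ), IsMatching σ ∧ σ.card = t := by
  obtain ⟨e⟩ : Nonempty (Fin t ↪ ι) := Function.Embedding.nonempty_of_card_le (by simpa)
  obtain ⟨f⟩ : Nonempty (Fin t ↪ κ) := Function.Embedding.nonempty_of_card_le (by simpa)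
  refine ⟨Finset.univ.map ⟨fun a => (e a, f a), fun a b h => e.injective (Prod.ext_iff.1 h).1⟩,
    ⟨?_, ?_⟩, by simp⟩
  · intro p hp q hq h
    obtain ⟨a, -, rfl⟩ := Finset.mem_map.1 hp
    obtain ⟨b, -, rfl⟩ := Finset.mem_map.1 hq
    rw [e.injective h]
  · intro p hp q hq h
    obtain ⟨a, -, rfl⟩ := Finset.mem_map.1 hp
    obtain ⟨b, -, rfl⟩ := Finset.mem_map.1 hq
    rw [f.injective h]

lemma exists_isMatching_min {ι κ : Type*} [Fintype ι] [Fintype κ] {t : ℕ}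
    (hι : t ≤ Fintype.card ι) (hκ : t ≤ Fintype.card κ) (X : ι × κ → ℝ) :
    ∃ σ : Finset (ι × κ), IsMatching σ ∧ σ.card = t ∧
      ∀ τ : Finset (ι × κ), IsMatching τ → τ.card = t → cost X σ ≤ cost X τ := by
  classical
  obtain ⟨σ₀, h1, h2⟩ := exists_isMatching_card hι hκ
  obtain ⟨σ, hσ, hmin⟩ := Finset.exists_min_image
    (Finset.univ.filter fun σ : Finset (ι × κ) => IsMatching σ ∧ σ.card = t) (cost X)
    ⟨σ₀, by simp [h1, h2]⟩
  simp only [Finset.mem_filter, Finset.mem_univ, true_and] at hσ hmin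
  exact ⟨σ, hσ.1, hσ.2, fun τ h3 h4 => hmin τ ⟨h3, h4⟩⟩

/-- The event that some optimal matching of size `#K` has column set `K`. -/
def optEvent (ι : Type*) {κ : Type*} [DecidableEq κ] (K : Finset κ) : Set (ι × κ → ℝ) :=
  {X | ∃ σ, IsMatching σ ∧ cols σ = K ∧
    ∀ τ, IsMatching τ → τ.card = K.card → cost X σ ≤ cost X τ}

/-- The event that `K` is the column set of an optimal matching of size `#K`, and `K ∪ {j}` that
of an optimal matching of size `#K + 1` containing `(i, j)`. Optimality is only demanded among the
matchings with at most one column outside `K`. -/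
def stepEvent {ι κ : Type*} [DecidableEq κ] (K : Finset κ) (i : ι) (j : κ) : Set (ι × κ → ℝ) :=
  {X | ∃ σ σ', IsMatching σ ∧ IsMatching σ' ∧ cols σ = K ∧ cols σ' = insert j K ∧ (i, j) ∈ σ' ∧
    ∀ τ, IsMatching τ → (cols τ \ K).card ≤ 1 →
      (τ.card = K.card → cost X σ ≤ cost X τ) ∧ (τ.card = K.card + 1 → cost X σ' ≤ cost X τ)}

lemma measurableSet_cost_le {ι κ : Type*} (σ τ : Finset (ι × κ)) :
    MeasurableSet {X : ι × κ → ℝ | cost X σ ≤ cost X τ} :=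
  measurableSet_le (measurable_cost σ) (measurable_cost τ)

lemma measurableSet_optEvent {ι κ : Type*} [Fintype ι] [Fintype κ] [DecidableEq κ] (K : Finset κ) :
    MeasurableSet (optEvent ι K) := by
  have : optEvent ι K = ⋃ (σ : Finset (ι × κ)) (_ : IsMatching σ) (_ : cols σ = K),
      ⋂ (τ : Finset (ι × κ)) (_ : IsMatching τ) (_ : τ.card = K.card),
        {X | cost X σ ≤ cost X τ} := by
    ext X
    simp only [optEvent, Set.mem_ofPred_eq, Set.mem_iUnion, Set.mem_iInter, exists_prop]
  rw [this]
  exact MeasurableSet.iUnion fun σ => MeasurableSet.iUnion fun _ => MeasurableSet.iUnion fun _ =>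
    MeasurableSet.iInter fun τ => MeasurableSet.iInter fun _ => MeasurableSet.iInter fun _ =>
    measurableSet_cost_le σ τ

lemma measurableSet_stepEvent {ι κ : Type*} [Fintype ι] [Fintype κ] [DecidableEq κ]
    (K : Finset κ) (i : ι) (j : κ) : MeasurableSet (stepEvent K i j) := by
  have : stepEvent K i j = ⋃ (σ : Finset (ι × κ)) (σ' : Finset (ι × κ)) (_ : IsMatching σ)
      (_ : IsMatching σ') (_ : cols σ = K) (_ : cols σ' = insert j K) (_ : (i, j) ∈ σ'),
      ⋂ (τ : Finset (ι × κ)) (_ : IsMatching τ) (_ : (cols τ \ K).card ≤ 1),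
        ((⋂ (_ : τ.card = K.card), {X | cost X σ ≤ cost X τ}) ∩
          ⋂ (_ : τ.card = K.card + 1), {X | cost X σ' ≤ cost X τ}) := by
    ext X
    simp only [stepEvent, Set.mem_ofPred_eq, Set.mem_iUnion, Set.mem_iInter, Set.mem_inter_iff,
      exists_prop]
  rw [this]
  exact MeasurableSet.iUnion fun σ => MeasurableSet.iUnion fun σ' => MeasurableSet.iUnion fun _ =>
    MeasurableSet.iUnion fun _ => MeasurableSet.iUnion fun _ => MeasurableSet.iUnion fun _ =>
    MeasurableSet.iUnion fun _ => MeasurableSet.iInter fun τ => MeasurableSet.iInter fun _ =>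
    MeasurableSet.iInter fun _ => (MeasurableSet.iInter fun _ => measurableSet_cost_le σ τ).inter
      (MeasurableSet.iInter fun _ => measurableSet_cost_le σ' τ)

/-- The restricted optimality in `stepEvent` implies full optimality: by `exists_cols_subset` a
competitor can be replaced, at no greater cost, by one that covers `K`, and this has at most one
further column. -/
lemma exists_optimal_of_mem_stepEvent {K : Finset κ} {i : ι} {j : κ} (hj : j ∉ K)
    {X : ι × κ → ℝ} (hX : X ∈ stepEvent K i j) :
    ∃ σ σ', IsMatching σ ∧ IsMatching σ' ∧ cols σ = K ∧ cols σ' = insert j K ∧ (i, j) ∈ σ' ∧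
      (∀ τ, IsMatching τ → τ.card = K.card → cost X σ ≤ cost X τ) ∧
      ∀ τ, IsMatching τ → τ.card = (insert j K).card → cost X σ' ≤ cost X τ := by
  obtain ⟨σ, σ', hσ, hσ', hc, hc', hij, hopt⟩ := hX
  have hcard : σ.card = K.card := by rw [← hσ.card_cols, hc]
  have key : ∀ τ, IsMatching τ → K.card ≤ τ.card → τ.card ≤ K.card + 1 →
      ∃ τ', IsMatching τ' ∧ (cols τ' \ K).card ≤ 1 ∧ τ'.card = τ.card ∧ cost X τ' ≤ cost X τ := by
    intro τ hτ h1 h2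
    obtain ⟨τ', h3, h4, h5, h6⟩ := exists_cols_subset X hσ
      (fun ρ hρ h h' => (hopt ρ hρ (hc ▸ h')).1 (h.trans hcard)) hτ (by omega)
    rw [hc] at h6
    refine ⟨τ', h3, ?_, h4, h5⟩
    rw [Finset.card_sdiff_of_subset h6, h3.card_cols]
    omega
  refine ⟨σ, σ', hσ, hσ', hc, hc', hij, fun τ hτ h => ?_, fun τ hτ h => ?_⟩
  · obtain ⟨τ', h3, h4, h5, h6⟩ := key τ hτ h.ge (by omega)
    exact ((hopt τ' h3 h4).1 (by omega)).trans h6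
  · rw [Finset.card_insert_of_notMem hj] at h
    obtain ⟨τ', h3, h4, h5, h6⟩ := key τ hτ (by omega) h.le
    exact ((hopt τ' h3 h4).2 (by omega)).trans h6

/-- If `X'` is obtained from `X` by changing the entries in row `i` and columns `j`, `j'` to values
not below `X (i, j)`, then the costs in `X'` are bounded below by costs in `X`. -/
lemma exists_cost_le_of_modify {K : Finset κ} {i : ι} {j j' : κ} (hj : j ∉ K) (hj' : j' ∉ K)
    (hjj' : j ≠ j') {X X' : ι × κ → ℝ} (hX : ∀ x, x ≠ (i, j) → x ≠ (i, j') → X' x = X x)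
    (h1 : X (i, j) ≤ X' (i, j)) (h2 : X (i, j) ≤ X' (i, j'))
    {τ : Finset (ι × κ)} (hτ : IsMatching τ) (hcard : (cols τ \ K).card ≤ 1) :
    ∃ ρ, IsMatching ρ ∧ (cols ρ \ K).card ≤ 1 ∧ ρ.card = τ.card ∧ cost X ρ ≤ cost X' τ := by
  by_cases hp : (i, j') ∈ τ
  · have hjτ : j ∉ cols τ := fun h => by
      have : ({j, j'} : Finset κ) ⊆ cols τ \ K := by
        intro x hx
        rcases Finset.mem_insert.1 hx with rfl | hx
        · exact Finset.mem_sdiff.2 ⟨h, hj⟩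
        · rw [Finset.mem_singleton.1 hx]
          exact Finset.mem_sdiff.2 ⟨mem_cols.2 ⟨i, hp⟩, hj'⟩
      have := Finset.card_le_card this
      rw [Finset.card_pair hjj'] at this
      omega
    have hr : (i, j).1 ∉ rows (τ.erase (i, j')) := by rw [hτ.rows_erase hp]; simp
    have hc : (i, j).2 ∉ cols (τ.erase (i, j')) := by rw [hτ.cols_erase hp]; simp [hjτ]
    refine ⟨insert (i, j) (τ.erase (i, j')), (hτ.mono (Finset.erase_subset _ _)).insert hr hc,
      ?_, ?_, ?_⟩
    · rw [cols_insert, hτ.cols_erase hp, Finset.insert_sdiff_of_notMem _ hj,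
        Finset.erase_sdiff_comm]
      refine (Finset.card_insert_le _ _).trans ?_
      rw [Finset.card_erase_of_mem (Finset.mem_sdiff.2 ⟨mem_cols.2 ⟨i, hp⟩, hj'⟩)]
      omega
    · rw [Finset.card_insert_of_notMem (fun h => hr (mem_rows.2 ⟨_, h⟩)),
        Finset.card_erase_add_one hp]
    · rw [cost_insert X hr, ← cost_erase X' hp]
      refine add_le_add h2 (Finset.sum_le_sum fun x hx => ?_)
      rw [hX x _ (Finset.ne_of_mem_erase hx)]
      rintro rfl
      exact hjτ (mem_cols.2 ⟨i, Finset.mem_of_mem_erase hx⟩)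
  · refine ⟨τ, hτ, hcard, rfl, Finset.sum_le_sum fun x hx => ?_⟩
    by_cases hx' : x = (i, j)
    · rw [hx']; exact h1
    · rw [hX x hx' (ne_of_mem_of_not_mem hx hp)]

/-- Moving the entry of a matching in row `i` from column `j` to the unused column `j'`. -/
lemma isMatching_move {K : Finset κ} {i : ι} {j j' : κ} (hj : j ∉ K) (hj' : j' ∉ K)
    {σ : Finset (ι × κ)} (hσ : IsMatching σ) (hc : cols σ = insert j K)
    (hij : (i, j) ∈ σ) (X : ι × κ → ℝ) :
    IsMatching (insert (i, j') (σ.erase (i, j))) ∧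
      cols (insert (i, j') (σ.erase (i, j))) = insert j' K ∧
      X (i, j) + cost X (insert (i, j') (σ.erase (i, j))) = X (i, j') + cost X σ := by
  have hr : (i, j').1 ∉ rows (σ.erase (i, j)) := by rw [hσ.rows_erase hij]; simp
  have hc2 : cols (σ.erase (i, j)) = K := by
    rw [hσ.cols_erase hij, hc, Finset.erase_insert hj]
  refine ⟨(hσ.mono (Finset.erase_subset _ _)).insert hr (by rw [hc2]; exact hj'), ?_, ?_⟩
  · rw [cols_insert, hc2]
  · rw [cost_insert X hr, ← cost_erase X hij]
    ring

lemma cost_congr {ι κ : Type*} {X Y : ι × κ → ℝ} {σ : Finset (ι × κ)} (h : ∀ x ∈ σ, X x = Y x) :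
    cost X σ = cost Y σ :=
  Finset.sum_congr rfl h

/-- Moving `(i, j)` to `(i, j')` in the larger optimal matching gives an admissible competitor. -/
lemma le_of_mem_stepEvent {K : Finset κ} {i : ι} {j j' : κ} (hj : j ∉ K) (hj' : j' ∉ K)
    {X : ι × κ → ℝ} (hX : X ∈ stepEvent K i j) : X (i, j) ≤ X (i, j') := by
  obtain ⟨σ, σ', hσ, hσ', hc, hc', hij, hopt⟩ := hX
  obtain ⟨h1, h2, h3⟩ := isMatching_move hj hj' hσ' hc' hij X
  have := (hopt _ h1 (by rw [h2, Finset.insert_sdiff_of_notMem _ hj']; simp)).2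
    (by rw [← h1.card_cols, h2, Finset.card_insert_of_notMem hj'])
  linarith

/-- Neither optimal matching uses `(i, j')`, and by `exists_cost_le_of_modify` no competitor can
undercut them while that entry stays at least `X (i, j)`. -/
lemma mem_stepEvent_of_le {K : Finset κ} {i : ι} {j j' : κ} (hj : j ∉ K) (hj' : j' ∉ K)
    (hjj' : j ≠ j') {X X' : ι × κ → ℝ} (hX : X ∈ stepEvent K i j)
    (hXX' : ∀ x, x ≠ (i, j') → X' x = X x) (hle : X (i, j) ≤ X' (i, j')) :
    X' ∈ stepEvent K i j := by
  obtain ⟨σ, σ', hσ, hσ', hc, hc', hij, hopt⟩ := hX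
  have e1 : cost X' σ = cost X σ := cost_congr fun x hx => hXX' x (by
    rintro rfl
    exact hj' (hc ▸ mem_cols.2 ⟨i, hx⟩))
  have e2 : cost X' σ' = cost X σ' := cost_congr fun x hx => hXX' x (by
    rintro rfl
    exact hjj' (Prod.ext_iff.1 (hσ'.1 _ hij _ hx rfl)).2)
  refine ⟨σ, σ', hσ, hσ', hc, hc', hij, fun τ hτ hcard => ?_⟩
  obtain ⟨ρ, r1, r2, r3, r4⟩ := exists_cost_le_of_modify hj hj' hjj' (fun x _ h => hXX' x h)
    (hXX' (i, j) (by simp [hjj'])).ge hle hτ hcard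
  rw [e1, e2, ← r3]
  exact ⟨fun h => ((hopt ρ r1 r2).1 h).trans r4, fun h => ((hopt ρ r1 r2).2 h).trans r4⟩

lemma comp_swap_mem_stepEvent {K : Finset κ} {i : ι} {j j' : κ} (hj : j ∉ K) (hj' : j' ∉ K)
    (hjj' : j ≠ j') {X : ι × κ → ℝ} (hX : X ∈ stepEvent K i j) :
    X ∘ Equiv.swap (i, j) (i, j') ∈ stepEvent K i j' := by
  have hle := le_of_mem_stepEvent hj hj' hX
  obtain ⟨σ, σ', hσ, hσ', hc, hc', hij, hopt⟩ := hX
  set X' := X ∘ Equiv.swap (i, j) (i, j') with hX'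
  have hp : X' (i, j) = X (i, j') := by simp [hX']
  have hq : X' (i, j') = X (i, j) := by simp [hX']
  have hXX' : ∀ x, x ≠ (i, j) → x ≠ (i, j') → X' x = X x := fun x h h' => by
    simp [hX', Equiv.swap_apply_of_ne_of_ne h h']
  obtain ⟨h1, h2, h3⟩ := isMatching_move hj hj' hσ' hc' hij X'
  have e1 : cost X' σ = cost X σ := cost_congr fun x hx => hXX' x
    (by rintro rfl; exact hj (hc ▸ mem_cols.2 ⟨i, hx⟩))
    (by rintro rfl; exact hj' (hc ▸ mem_cols.2 ⟨i, hx⟩))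
  have e2 : cost X' (insert (i, j') (σ'.erase (i, j))) = cost X σ' := by
    have e3 : cost X' (σ'.erase (i, j)) = cost X (σ'.erase (i, j)) := cost_congr fun x hx =>
      hXX' x (Finset.ne_of_mem_erase hx) (by
        rintro rfl
        exact hjj' (Prod.ext_iff.1 (hσ'.1 _ hij _ (Finset.mem_of_mem_erase hx) rfl)).2)
    have := cost_erase X hij
    have := cost_erase X' hij
    linarith
  refine ⟨σ, _, hσ, h1, hc, h2, Finset.mem_insert_self _ _, fun τ hτ hcard => ?_⟩
  obtain ⟨ρ, r1, r2, r3, r4⟩ := exists_cost_le_of_modify hj hj' hjj' hXX'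
    (hle.trans hp.ge) hq.ge hτ hcard
  rw [e1, e2, ← r3]
  exact ⟨fun h => ((hopt ρ r1 r2).1 h).trans r4, fun h => ((hopt ρ r1 r2).2 h).trans r4⟩

variable [Fintype ι] [Fintype κ]

lemma rate_mul_stepEvent {A : ι × κ → ℝ} (hA : ∀ p, 0 < A p) {K : Finset κ} (i : ι) {j j' : κ}
    (hj : j ∉ K) (hj' : j' ∉ K) :
    ENNReal.ofReal (A (i, j')) * expMatrixLaw A (stepEvent K i j) =
      ENNReal.ofReal (A (i, j)) * expMatrixLaw A (stepEvent K i j') := by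
  rcases eq_or_ne j j' with rfl | hjj'
  · rfl
  refine rate_mul_measure_eq hA (by simp [hjj']) (measurableSet_stepEvent K i j)
    (measurableSet_stepEvent K i j') (fun X hX => le_of_mem_stepEvent hj hj' hX)
    (fun X hX t ht => mem_stepEvent_of_le hj hj' hjj' hX
      (fun x hx => Function.update_of_ne hx _ _) (by simpa using ht)) fun X => ⟨fun h => ?_,
      fun h => ?_⟩
  · have := comp_swap_mem_stepEvent hj hj' hjj' h
    rwa [Function.comp_assoc, ← Equiv.coe_trans, ← Equiv.Perm.mul_def, Equiv.swap_mul_self,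
      Equiv.Perm.coe_one, Function.comp_id] at this
  · rw [Equiv.swap_comm]
    exact comp_swap_mem_stepEvent hj' hj hjj'.symm h

lemma eq_of_notMem_closeCosts {ι κ : Type*} {X : ι × κ → ℝ} (hX : X ∉ closeCosts ι κ 0)
    {σ τ : Finset (ι × κ)} (h1 : cost X σ ≤ cost X τ) (h2 : cost X τ ≤ cost X σ) : σ = τ := by
  by_contra h
  exact hX ⟨σ, τ, h, by simp [le_antisymm h1 h2]⟩

/-- Without ties the optimal matchings of the two sizes are unique. They determine `K`, the added
column `j`, and the row `i` in which it is used. -/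
lemma aedisjoint_stepEvent {A : ι × κ → ℝ} (hA : ∀ p, 0 < A p) {K₁ K₂ : Finset κ}
    (hK : K₁.card = K₂.card) {i₁ i₂ : ι} {j₁ j₂ : κ} (hj₁ : j₁ ∉ K₁) (hj₂ : j₂ ∉ K₂)
    (hne : ¬ (K₁ = K₂ ∧ i₁ = i₂ ∧ j₁ = j₂)) :
    AEDisjoint (expMatrixLaw A) (stepEvent K₁ i₁ j₁) (stepEvent K₂ i₂ j₂) := by
  refine measure_mono_null (fun X hX => ?_) (measure_closeCosts_zero hA)
  by_contra hcl
  obtain ⟨σ₁, σ₁', m₁, m₁', c₁, c₁', p₁, o₁, o₁'⟩ := exists_optimal_of_mem_stepEvent hj₁ hX.1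
  obtain ⟨σ₂, σ₂', m₂, m₂', c₂, c₂', p₂, o₂, o₂'⟩ := exists_optimal_of_mem_stepEvent hj₂ hX.2
  have k1 : (insert j₁ K₁).card = (insert j₂ K₂).card := by
    rw [Finset.card_insert_of_notMem hj₁, Finset.card_insert_of_notMem hj₂, hK]
  have e : σ₁ = σ₂ := eq_of_notMem_closeCosts hcl
    (o₁ _ m₂ (by rw [← m₂.card_cols, c₂, hK])) (o₂ _ m₁ (by rw [← m₁.card_cols, c₁, hK]))
  have e' : σ₁' = σ₂' := eq_of_notMem_closeCosts hcl
    (o₁' _ m₂' (by rw [← m₂'.card_cols, c₂', k1])) (o₂' _ m₁' (by rw [← m₁'.card_cols, c₁', k1]))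
  subst e e'
  have hKK : K₁ = K₂ := c₁.symm.trans c₂
  subst hKK
  have hj : j₁ = j₂ := by
    have : j₁ ∈ insert j₂ K₁ := by rw [← c₂', c₁']; exact Finset.mem_insert_self _ _
    exact (Finset.mem_insert.1 this).resolve_right hj₁
  subst hj
  exact hne ⟨rfl, (Prod.ext_iff.1 (m₁'.2 _ p₁ _ p₂ rfl)).1, rfl⟩

/-- An optimal matching of size `#K` with columns `K` extends to an optimal one of size `#K + 1`
in columns. -/
lemma optEvent_eq_iUnion {K : Finset κ} (hι : K.card < Fintype.card ι)
    (hκ : K.card < Fintype.card κ) :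
    optEvent ι K = ⋃ x ∈ Kᶜ ×ˢ (Finset.univ : Finset ι), stepEvent K x.2 x.1 := by
  ext X
  simp only [Set.mem_iUnion, Finset.mem_product, Finset.mem_compl, Finset.mem_univ, and_true,
    exists_prop, Prod.exists]
  constructor
  · rintro ⟨σ, hσ, hc, hopt⟩
    have hcard : σ.card = K.card := by rw [← hσ.card_cols, hc]
    obtain ⟨τ, hτ, h1, h2⟩ := exists_isMatching_min (t := K.card + 1) hι hκ X
    obtain ⟨τ', h3, h4, h5, h6⟩ := exists_cols_subset X hσ
      (fun ρ hρ h _ => hopt ρ hρ (h.trans hcard)) hτ (by omega)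
    rw [hc] at h6
    obtain ⟨j, hj⟩ : ∃ j, cols τ' \ K = {j} := by
      rw [← Finset.card_eq_one, Finset.card_sdiff_of_subset h6, h3.card_cols]
      omega
    have hj' : j ∈ cols τ' \ K := by rw [hj]; simp
    rw [Finset.mem_sdiff] at hj'
    obtain ⟨i, hi⟩ := mem_cols.1 hj'.1
    refine ⟨j, i, hj'.2, σ, τ', hσ, h3, hc, ?_, hi, fun ρ hρ _ => ⟨hopt ρ hρ,
      fun h => h5.trans (h2 ρ hρ h)⟩⟩
    rw [← Finset.sdiff_union_of_subset h6, hj]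
    rfl
  · rintro ⟨j, i, hj, h⟩
    obtain ⟨σ, σ', hσ, -, hc, -, -, h1, -⟩ := exists_optimal_of_mem_stepEvent hj h
    exact ⟨σ, hσ, hc, h1⟩

/-- The nesting read downwards: the columns of the optimal matching one size smaller lie in `K`. The
equality is only almost sure, since `exists_cols_subset` may return another optimal matching, which
uniqueness identifies with the given one. -/
lemma optEvent_ae_eq_iUnion {A : ι × κ → ℝ} (hA : ∀ p, 0 < A p) {K : Finset κ}
    (hK : K.Nonempty) (hι : K.card ≤ Fintype.card ι) :
    optEvent ι K =ᵐ[expMatrixLaw A]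
      ⋃ x ∈ K ×ˢ (Finset.univ : Finset ι), stepEvent (K.erase x.1) x.2 x.1 := by
  have h0 : ∀ᵐ X ∂expMatrixLaw A, X ∉ closeCosts ι κ 0 :=
    measure_eq_zero_iff_ae_notMem.1 (measure_closeCosts_zero hA)
  refine Filter.eventuallyEq_set.2 ?_
  filter_upwards [h0] with X hX
  simp only [Set.mem_iUnion, Finset.mem_product, Finset.mem_univ, and_true,
    exists_prop, Prod.exists]
  constructor
  · rintro ⟨τ, hτ, hc, hopt⟩
    have hcard : τ.card = K.card := by rw [← hτ.card_cols, hc]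
    have hpos := hK.card_pos
    obtain ⟨σ, hσ, h1, h2⟩ := exists_isMatching_min (t := K.card - 1) (by omega)
      (by have := Finset.card_le_univ K; omega) X
    obtain ⟨τ', h3, h4, h5, h6⟩ := exists_cols_subset X hσ
      (fun ρ hρ h _ => h2 ρ hρ (h.trans h1)) hτ (by omega)
    obtain rfl : τ' = τ := eq_of_notMem_closeCosts hX h5 (hopt _ h3 (h4.trans hcard))
    rw [hc] at h6
    obtain ⟨j, hj⟩ : ∃ j, K \ cols σ = {j} := by
      rw [← Finset.card_eq_one, Finset.card_sdiff_of_subset h6, hσ.card_cols]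
      omega
    have hj' : j ∈ K \ cols σ := by rw [hj]; simp
    rw [Finset.mem_sdiff] at hj'
    obtain ⟨i, hi⟩ := mem_cols.1 (hc.symm ▸ hj'.1)
    have hcσ : cols σ = K.erase j := by
      rw [← Finset.sdiff_singleton_eq_erase, ← hj, Finset.sdiff_sdiff_eq_self h6]
    have hce : (K.erase j).card = K.card - 1 := Finset.card_erase_of_mem hj'.1
    refine ⟨j, i, hj'.1, σ, τ', hσ, hτ, hcσ, ?_, hi, fun ρ hρ _ => ⟨fun h => h2 ρ hρ (by omega),
      fun h => hopt ρ hρ (by omega)⟩⟩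
    rw [Finset.insert_erase hj'.1, hc]
  · rintro ⟨j, i, hj, h⟩
    obtain ⟨-, σ', -, hσ', -, hc, -, -, h1⟩ :=
      exists_optimal_of_mem_stepEvent (Finset.notMem_erase j K) h
    rw [Finset.insert_erase hj] at hc h1
    exact ⟨σ', hσ', hc, h1⟩

lemma isProbabilityMeasure_expMatrixLaw {ι κ : Type*} [Fintype ι] [Fintype κ] {A : ι × κ → ℝ}
    (hA : ∀ p, 0 < A p) : IsProbabilityMeasure (expMatrixLaw A) := by
  have := fun p => isProbabilityMeasure_expMeasure (hA p)
  exact inferInstanceAs (IsProbabilityMeasure (Measure.pi _))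

/-- The column set of the optimal matching of size `t` is distributed as the set of the first `t`
balls drawn from an urn. -/
theorem measureReal_optEvent {r : ι → ℝ} {c : κ → ℝ} (hr : ∀ i, 0 < r i) (hc : ∀ j, 0 < c j)
    (K : Finset κ) (hK : K.card ≤ Fintype.card ι) :
    (expMatrixLaw fun p : ι × κ => r p.1 * c p.2).real (optEvent ι K) = Pr c K := by
  have hA : ∀ p : ι × κ, 0 < r p.1 * c p.2 := fun p => mul_pos (hr _) (hc _)
  have := isProbabilityMeasure_expMatrixLaw hA
  set μ := expMatrixLaw fun p : ι × κ => r p.1 * c p.2 with hμ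
  -- One draw of the urn: given that `K` is the optimal column set, the next column is `j` with
  -- probability `c j` over the total weight outside `K`.
  have hstep : ∀ (K : Finset κ) (j : κ), j ∉ K → K.card < Fintype.card ι →
      ∑ i, μ.real (stepEvent K i j) = μ.real (optEvent ι K) * (c j / (∑ a, c a - ∑ a ∈ K, c a)) := by
    intro K j hj hKι
    have hKκ : K.card < Fintype.card κ := Finset.card_lt_univ_of_notMem hj
    have e1 : μ.real (optEvent ι K) = ∑ j ∈ Kᶜ, ∑ i, μ.real (stepEvent K i j) := by
      rw [← Finset.sum_product', optEvent_eq_iUnion hKι hKκ, measureReal_biUnion_finset₀]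
      · rintro ⟨j₁, i₁⟩ h₁ ⟨j₂, i₂⟩ h₂ hne
        simp only [Finset.coe_product, Set.mem_prod, Finset.mem_coe, Finset.mem_compl] at h₁ h₂
        exact aedisjoint_stepEvent hA rfl h₁.1 h₂.1 fun h => hne (Prod.ext h.2.2 h.2.1)
      · exact fun x _ => (measurableSet_stepEvent _ _ _).nullMeasurableSet
    have e2 : ∀ j' ∈ Kᶜ, c j * ∑ i, μ.real (stepEvent K i j') =
        c j' * ∑ i, μ.real (stepEvent K i j) := by
      intro j' hj'
      rw [Finset.mem_compl] at hj'
      rw [Finset.mul_sum, Finset.mul_sum]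
      refine Finset.sum_congr rfl fun i _ => ?_
      have := congrArg ENNReal.toReal (rate_mul_stepEvent hA i hj hj')
      rw [ENNReal.toReal_mul, ENNReal.toReal_mul, ENNReal.toReal_ofReal (hA _).le,
        ENNReal.toReal_ofReal (hA _).le] at this
      simp only [mul_assoc] at this
      -- Here the rank one form is used: the factor `r i` cancels, so the ratio does not depend on
      -- the row and survives summation over `i`.
      exact (mul_left_cancel₀ (hr i).ne' this).symm
    have e3 : ∑ a, c a - ∑ a ∈ K, c a = ∑ a ∈ Kᶜ, c a := by
      rw [← Finset.sum_add_sum_compl K]; ring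
    have e4 : 0 < ∑ a ∈ Kᶜ, c a := Finset.sum_pos (fun a _ => hc a) ⟨j, by simp [hj]⟩
    have e5 : c j * ∑ j' ∈ Kᶜ, ∑ i, μ.real (stepEvent K i j') =
        (∑ a ∈ Kᶜ, c a) * ∑ i, μ.real (stepEvent K i j) := by
      rw [Finset.mul_sum, Finset.sum_congr rfl e2, Finset.sum_mul]
    rw [e3, e1, ← mul_div_assoc, eq_div_iff e4.ne']
    linarith
  induction hn : K.card generalizing K with
  | zero =>
    rw [Finset.card_eq_zero] at hn
    subst hn
    have : optEvent ι (∅ : Finset κ) = Set.univ := by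
      refine Set.eq_univ_of_forall fun X => ⟨∅, isMatching_empty, rfl, fun τ _ h => ?_⟩
      rw [Finset.card_empty, Finset.card_eq_zero] at h
      rw [h]
    rw [this, Pr_empty, probReal_univ]
  | succ n ih =>
    have hne : K.Nonempty := Finset.card_pos.1 (by omega)
    rw [Pr_eq_sum_erase c hne, measureReal_congr (optEvent_ae_eq_iUnion hA hne hK),
      measureReal_biUnion_finset₀, Finset.sum_product]
    · refine Finset.sum_congr rfl fun j hj => ?_
      have := Finset.card_erase_of_mem hj
      rw [hstep _ _ (Finset.notMem_erase j K) (by omega), ih _ (by omega) (by omega)]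
    · rintro ⟨j₁, i₁⟩ h₁ ⟨j₂, i₂⟩ h₂ hne
      simp only [Finset.coe_product, Set.mem_prod, Finset.mem_coe] at h₁ h₂
      refine aedisjoint_stepEvent hA ?_ (Finset.notMem_erase _ _) (Finset.notMem_erase _ _)
        fun h => hne (Prod.ext h.2.2 h.2.1)
      rw [Finset.card_erase_of_mem h₁.1, Finset.card_erase_of_mem h₂.1]
    · exact fun x _ => (measurableSet_stepEvent _ _ _).nullMeasurableSet

end OptimalColumns

/-! ### Deterministic comparison of the glued matrix with its two blocks. -/

section Blocks

lemma minAssign_le {ι κ : Type*} [Fintype ι] [Fintype κ] (X : ι × κ → ℝ) {σ : Finset (ι × κ)}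
    (hσ : IsMatching σ) {k : ℕ} (hk : σ.card = k) : minAssign k X ≤ cost X σ :=
  ciInf_le (Set.finite_range _).bddBelow
    (⟨σ, hk, hσ⟩ : {σ : Finset (ι × κ) // IsAssignment k σ})

lemma exists_cost_eq_minAssign {ι κ : Type*} [Fintype ι] [Fintype κ] {k : ℕ}
    (hι : k ≤ Fintype.card ι) (hκ : k ≤ Fintype.card κ) (X : ι × κ → ℝ) :
    ∃ σ : Finset (ι × κ), IsMatching σ ∧ σ.card = k ∧ minAssign k X = cost X σ := by
  obtain ⟨σ₀, h1, h2⟩ := exists_isMatching_card hι hκ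
  have : Nonempty {σ : Finset (ι × κ) // IsAssignment k σ} := ⟨⟨σ₀, h2, h1⟩⟩
  obtain ⟨σ, hσ⟩ := exists_eq_ciInf_of_finite
    (f := fun σ : {σ : Finset (ι × κ) // IsAssignment k σ} => ∑ p ∈ σ.1, X p)
  exact ⟨σ.1, σ.2.2, σ.2.1, hσ.symm⟩

lemma cost_nonneg {ι κ : Type*} {X : ι × κ → ℝ} (hX : ∀ p, 0 ≤ X p) (σ : Finset (ι × κ)) :
    0 ≤ cost X σ :=
  Finset.sum_nonneg fun p _ => hX p

lemma cost_le_sum {ι κ : Type*} [Fintype ι] [Fintype κ] {X : ι × κ → ℝ} (hX : ∀ p, 0 ≤ X p)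
    (σ : Finset (ι × κ)) : cost X σ ≤ ∑ p, X p :=
  Finset.sum_le_univ_sum_of_nonneg hX

lemma cost_mono {ι κ : Type*} {X : ι × κ → ℝ} (hX : ∀ p, 0 ≤ X p) {σ τ : Finset (ι × κ)}
    (h : σ ⊆ τ) : cost X σ ≤ cost X τ :=
  Finset.sum_le_sum_of_subset_of_nonneg h fun p _ _ => hX p

lemma minAssign_nonneg {ι κ : Type*} {X : ι × κ → ℝ} (hX : ∀ p, 0 ≤ X p) (k : ℕ) :
    0 ≤ minAssign k X :=
  Real.iInf_nonneg fun σ => cost_nonneg hX σ.1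

lemma minAssign_le_sum {ι κ : Type*} [Fintype ι] [Fintype κ] {X : ι × κ → ℝ}
    (hX : ∀ p, 0 ≤ X p) {k : ℕ} (hι : k ≤ Fintype.card ι) (hκ : k ≤ Fintype.card κ) :
    minAssign k X ≤ ∑ p, X p := by
  obtain ⟨σ, -, -, h⟩ := exists_cost_eq_minAssign hι hκ X
  exact h ▸ cost_le_sum hX σ

/-- A set of at least `t` positions contained in a matching costs at least `min_t`, if the entries
are nonnegative. -/
lemma minAssign_le_of_le_card {ι κ : Type*} [Fintype ι] [Fintype κ] {X : ι × κ → ℝ}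
    (hX : ∀ p, 0 ≤ X p) {t : ℕ} {σ : Finset (ι × κ)} (hσ : IsMatching σ) (ht : t ≤ σ.card) :
    minAssign t X ≤ cost X σ := by
  obtain ⟨τ, h1, h2⟩ := Finset.exists_subset_card_eq ht
  exact (minAssign_le X (hσ.mono h1) h2).trans (cost_mono hX h1)

section Map

variable {ι κ ι' κ' : Type*}

lemma isMatching_map_iff (f : ι ↪ ι') (g : κ ↪ κ') {σ : Finset (ι × κ)} :
    IsMatching (σ.map (f.prodMap g)) ↔ IsMatching σ := by
  simp only [IsMatching, Finset.forall_mem_map, Function.Embedding.prodMap,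
    Function.Embedding.coeFn_mk, Prod.map_fst, Prod.map_snd, EmbeddingLike.apply_eq_iff_eq,
    (f.injective.prodMap g.injective).eq_iff]

lemma cols_map [DecidableEq κ] [DecidableEq κ'] (f : ι ↪ ι') (g : κ ↪ κ')
    (σ : Finset (ι × κ)) : cols (σ.map (f.prodMap g)) = (cols σ).map g := by
  ext j
  simp only [mem_cols, Finset.mem_map]
  constructor
  · rintro ⟨i, p, hp, h⟩
    exact ⟨p.2, ⟨p.1, hp⟩, (Prod.ext_iff.1 h).2⟩
  · rintro ⟨j, ⟨i, hp⟩, rfl⟩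
    exact ⟨f i, (i, j), hp, rfl⟩

lemma cost_map (X : ι' × κ' → ℝ) (f : ι ↪ ι') (g : κ ↪ κ') (σ : Finset (ι × κ)) :
    cost X (σ.map (f.prodMap g)) = cost (fun p => X (f p.1, g p.2)) σ :=
  Finset.sum_map _ _ _

end Map

variable {ι ι₁ ι₂ κ : Type*}

/-- The matrix with rows `ι` consisting of the top block `T` and the bottom block `B`. -/
def glue (e : ι₁ ⊕ ι₂ ≃ ι) (T : ι₁ × κ → ℝ) (B : ι₂ × κ → ℝ) (p : ι × κ) : ℝ :=
  Sum.elim (fun i => T (i, p.2)) (fun i => B (i, p.2)) (e.symm p.1)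

lemma glue_inl (e : ι₁ ⊕ ι₂ ≃ ι) (T : ι₁ × κ → ℝ) (B : ι₂ × κ → ℝ) (i : ι₁) (j : κ) :
    glue e T B (e (.inl i), j) = T (i, j) := by simp [glue]

lemma glue_inr (e : ι₁ ⊕ ι₂ ≃ ι) (T : ι₁ × κ → ℝ) (B : ι₂ × κ → ℝ) (i : ι₂) (j : κ) :
    glue e T B (e (.inr i), j) = B (i, j) := by simp [glue]

variable [DecidableEq κ]

/-- Positions in different blocks never share a row, so only the columns can clash. -/
lemma exists_join (e : ι₁ ⊕ ι₂ ≃ ι) {ρ₁ : Finset (ι₁ × κ)} {ρ₂ : Finset (ι₂ × κ)}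
    (h₁ : IsMatching ρ₁) (h₂ : IsMatching ρ₂) (hd : Disjoint (cols ρ₁) (cols ρ₂)) :
    ∃ ρ : Finset (ι × κ), IsMatching ρ ∧ ρ.card = ρ₁.card + ρ₂.card ∧
      ∀ T B, cost (glue e T B) ρ = cost T ρ₁ + cost B ρ₂ := by
  classical
  set f₁ : ι₁ ↪ ι := Function.Embedding.inl.trans e.toEmbedding with hf₁
  set f₂ : ι₂ ↪ ι := Function.Embedding.inr.trans e.toEmbedding with hf₂
  set σ₁ := ρ₁.map (f₁.prodMap (Function.Embedding.refl κ)) with hσ₁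
  set σ₂ := ρ₂.map (f₂.prodMap (Function.Embedding.refl κ)) with hσ₂
  have m₁ : IsMatching σ₁ := (isMatching_map_iff _ _).2 h₁
  have m₂ : IsMatching σ₂ := (isMatching_map_iff _ _).2 h₂
  have hrow : ∀ p ∈ σ₁, ∀ q ∈ σ₂, p.1 ≠ q.1 := by
    intro p hp q hq
    obtain ⟨a, -, rfl⟩ := Finset.mem_map.1 hp
    obtain ⟨b, -, rfl⟩ := Finset.mem_map.1 hq
    simp [hf₁, hf₂]
  have hcol : ∀ p ∈ σ₁, ∀ q ∈ σ₂, p.2 ≠ q.2 := by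
    intro p hp q hq
    obtain ⟨a, ha, rfl⟩ := Finset.mem_map.1 hp
    obtain ⟨b, hb, rfl⟩ := Finset.mem_map.1 hq
    exact fun h => Finset.disjoint_left.1 hd (mem_cols.2 ⟨a.1, ha⟩)
      (mem_cols.2 ⟨b.1, (show a.2 = b.2 from h) ▸ hb⟩)
  have hdisj : Disjoint σ₁ σ₂ := Finset.disjoint_left.2 fun p hp hq => hrow p hp p hq rfl
  refine ⟨σ₁ ∪ σ₂, ⟨fun p hp q hq h => ?_, fun p hp q hq h => ?_⟩, ?_, fun T B => ?_⟩
  · rcases Finset.mem_union.1 hp with hp | hp <;> rcases Finset.mem_union.1 hq with hq | hq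
    · exact m₁.1 p hp q hq h
    · exact absurd h (hrow p hp q hq)
    · exact absurd h.symm (hrow q hq p hp)
    · exact m₂.1 p hp q hq h
  · rcases Finset.mem_union.1 hp with hp | hp <;> rcases Finset.mem_union.1 hq with hq | hq
    · exact m₁.2 p hp q hq h
    · exact absurd h (hcol p hp q hq)
    · exact absurd h.symm (hcol q hq p hp)
    · exact m₂.2 p hp q hq h
  · rw [Finset.card_union_of_disjoint hdisj, Finset.card_map, Finset.card_map]
  · rw [cost, Finset.sum_union hdisj]
    have := cost_map (glue e T B) f₁ (Function.Embedding.refl κ) ρ₁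
    have := cost_map (glue e T B) f₂ (Function.Embedding.refl κ) ρ₂
    simp_all [cost, glue_inl, glue_inr]

variable [Fintype ι₁] [Fintype ι₂] [Fintype κ]

lemma exists_blocks (e : ι₁ ⊕ ι₂ ≃ ι) {ρ : Finset (ι × κ)} (hρ : IsMatching ρ) :
    ∃ (ρ₁ : Finset (ι₁ × κ)) (ρ₂ : Finset (ι₂ × κ)), IsMatching ρ₁ ∧ IsMatching ρ₂ ∧
      Disjoint (cols ρ₁) (cols ρ₂) ∧ ρ.card = ρ₁.card + ρ₂.card ∧
      ∀ T B, cost (glue e T B) ρ = cost T ρ₁ + cost B ρ₂ := by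
  classical
  set f₁ : ι₁ ↪ ι := Function.Embedding.inl.trans e.toEmbedding with hf₁
  set f₂ : ι₂ ↪ ι := Function.Embedding.inr.trans e.toEmbedding with hf₂
  obtain ⟨ρ₁, -, h₁⟩ : ∃ ρ₁ ⊆ Finset.univ, ρ.filter (fun p => (e.symm p.1).isLeft = true) =
      ρ₁.map (f₁.prodMap (Function.Embedding.refl κ)) := by
    rw [← Finset.subset_map_iff]
    intro p hp
    obtain ⟨i, hi⟩ := Sum.isLeft_iff.1 (Finset.mem_filter.1 hp).2
    exact Finset.mem_map.2 ⟨(i, p.2), Finset.mem_univ _, Prod.ext (by simp [hf₁, ← hi]) rfl⟩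
  obtain ⟨ρ₂, -, h₂⟩ : ∃ ρ₂ ⊆ Finset.univ, ρ.filter (fun p => ¬ (e.symm p.1).isLeft = true) =
      ρ₂.map (f₂.prodMap (Function.Embedding.refl κ)) := by
    rw [← Finset.subset_map_iff]
    intro p hp
    obtain ⟨i, hi⟩ := Sum.isRight_iff.1 (Sum.not_isLeft.1 (Finset.mem_filter.1 hp).2)
    exact Finset.mem_map.2 ⟨(i, p.2), Finset.mem_univ _, Prod.ext (by simp [hf₂, ← hi]) rfl⟩
  refine ⟨ρ₁, ρ₂, ?_, ?_, ?_, ?_, fun T B => ?_⟩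
  · rw [← isMatching_map_iff f₁ (Function.Embedding.refl κ), ← h₁]
    exact hρ.mono (Finset.filter_subset _ _)
  · rw [← isMatching_map_iff f₂ (Function.Embedding.refl κ), ← h₂]
    exact hρ.mono (Finset.filter_subset _ _)
  · rw [Finset.disjoint_left]
    intro j hj₁ hj₂
    obtain ⟨i₁, hi₁⟩ := mem_cols.1 hj₁
    obtain ⟨i₂, hi₂⟩ := mem_cols.1 hj₂
    have m₁ : (f₁ i₁, j) ∈ ρ := (Finset.mem_filter.1 (h₁ ▸ Finset.mem_map_of_mem _ hi₁)).1
    have m₂ : (f₂ i₂, j) ∈ ρ := (Finset.mem_filter.1 (h₂ ▸ Finset.mem_map_of_mem _ hi₂)).1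
    have := (Prod.ext_iff.1 (hρ.2 _ m₁ _ m₂ rfl)).1
    simp [hf₁, hf₂] at this
  · rw [← Finset.card_filter_add_card_filter_not (s := ρ) (fun p => (e.symm p.1).isLeft = true),
      h₁, h₂, Finset.card_map, Finset.card_map]
  · rw [cost, ← Finset.sum_filter_add_sum_filter_not ρ (fun p => (e.symm p.1).isLeft = true),
      h₁, h₂]
    have := cost_map (glue e T B) f₁ (Function.Embedding.refl κ) ρ₁
    have := cost_map (glue e T B) f₂ (Function.Embedding.refl κ) ρ₂
    simp_all [cost, glue_inl, glue_inr]

variable [Fintype ι]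

/-- The matrix `X` with the columns in `K` deleted. -/
def deleteCols {ι κ : Type*} (K : Finset κ) (X : ι × κ → ℝ) (p : ι × {j // j ∉ K}) : ℝ :=
  X (p.1, p.2)

lemma minAssign_deleteCols_le (K : Finset κ) (X : ι × κ → ℝ) {σ : Finset (ι × κ)}
    (hσ : IsMatching σ) (hd : Disjoint K (cols σ)) {k : ℕ} (hk : σ.card = k) :
    minAssign k (deleteCols K X) ≤ cost X σ := by
  classical
  set g : {j // j ∉ K} ↪ κ := Function.Embedding.subtype _
  obtain ⟨τ, -, hτ⟩ : ∃ τ ⊆ Finset.univ, σ =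
      τ.map ((Function.Embedding.refl ι).prodMap g) := by
    rw [← Finset.subset_map_iff]
    intro p hp
    exact Finset.mem_map.2 ⟨(p.1, ⟨p.2, fun h => Finset.disjoint_left.1 hd h
      (mem_cols.2 ⟨p.1, hp⟩)⟩), Finset.mem_univ _, rfl⟩
  rw [hτ, cost_map]
  exact minAssign_le (deleteCols K X) ((isMatching_map_iff _ _).1 (hτ ▸ hσ))
    (by rw [← hk, hτ, Finset.card_map])

lemma exists_cost_eq_minAssign_deleteCols {K : Finset κ} {k : ℕ} (hι : k ≤ Fintype.card ι)
    (hκ : k + K.card ≤ Fintype.card κ) (X : ι × κ → ℝ) :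
    ∃ σ : Finset (ι × κ), IsMatching σ ∧ σ.card = k ∧ Disjoint K (cols σ) ∧
      minAssign k (deleteCols K X) = cost X σ := by
  classical
  obtain ⟨τ, h1, h2, h3⟩ := exists_cost_eq_minAssign (k := k) hι
    (by rw [Fintype.card_subtype_compl, Fintype.card_coe]; omega) (deleteCols K X)
  refine ⟨τ.map ((Function.Embedding.refl ι).prodMap (Function.Embedding.subtype _)),
    (isMatching_map_iff _ _).2 h1, by rw [Finset.card_map, h2], ?_, by rw [h3, cost_map]; rfl⟩
  rw [cols_map, Finset.disjoint_right]
  intro j hj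
  obtain ⟨a, -, rfl⟩ := Finset.mem_map.1 hj
  exact a.2

variable (e : ι₁ ⊕ ι₂ ≃ ι) {T : ι₁ × κ → ℝ} {B : ι₂ × κ → ℝ}

lemma minAssign_glue_le {k : ℕ} (hk : k ≤ Fintype.card ι₂) (hκ : k ≤ Fintype.card κ) :
    minAssign k (glue e T B) ≤ minAssign k B := by
  obtain ⟨σ, h1, h2, h3⟩ := exists_cost_eq_minAssign hk hκ B
  obtain ⟨ρ, r1, r2, r3⟩ := exists_join e (ρ₁ := ∅) isMatching_empty h1 (by simp [cols])
  rw [h3]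
  refine (minAssign_le _ r1 (by simpa [h2] using r2)).trans ?_
  rw [r3]
  simp [cost]

/-- Compared with the empty set, every nonempty set of top positions costs more than the whole
bottom block, so an optimal matching uses none. -/
lemma minAssign_glue_eq (hT : ∀ p, 0 ≤ T p) (hB : ∀ p, 0 ≤ B p) {k : ℕ}
    (hk : k ≤ Fintype.card ι₂) (hκ : k ≤ Fintype.card κ)
    (hcl : T ∉ closeCosts ι₁ κ (∑ p, B p)) :
    minAssign k (glue e T B) = minAssign k B := by
  refine le_antisymm (minAssign_glue_le e hk hκ) ?_
  have hι : k ≤ Fintype.card ι := by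
    rw [← Fintype.card_congr e, Fintype.card_sum]; omega
  obtain ⟨ρ, h1, h2, h3⟩ := exists_cost_eq_minAssign hι hκ (glue e T B)
  obtain ⟨ρ₁, ρ₂, m₁, m₂, -, hc, hcost⟩ := exists_blocks e h1
  rw [h3, hcost]
  have hn := cost_nonneg hB ρ₂
  by_cases h : ρ₁ = ∅
  · subst h
    have := minAssign_le B m₂ (k := k) (by simpa [h2] using hc.symm)
    simpa [cost] using this
  · have : ∑ p, B p < cost T ρ₁ := by
      by_contra! hle
      have h0 : cost T ∅ = 0 := Finset.sum_empty
      exact hcl ⟨ρ₁, ∅, h, by rwa [h0, sub_zero, abs_of_nonneg (cost_nonneg hT ρ₁)]⟩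
    have := minAssign_le_sum hB hk hκ
    linarith

/-- The bottom block holds at most one position per row, so at least `t` positions lie in the top
block. -/
lemma minAssign_le_minAssign_glue (hT : ∀ p, 0 ≤ T p) (hB : ∀ p, 0 ≤ B p) {t : ℕ}
    (ht : t ≤ Fintype.card ι₁) (hκ : t + Fintype.card ι₂ ≤ Fintype.card κ) :
    minAssign t T ≤ minAssign (t + Fintype.card ι₂) (glue e T B) := by
  classical
  obtain ⟨ρ, h1, h2, h3⟩ := exists_cost_eq_minAssign
    (by rw [← Fintype.card_congr e, Fintype.card_sum]; omega) hκ (glue e T B)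
  obtain ⟨ρ₁, ρ₂, m₁, m₂, -, hc, hcost⟩ := exists_blocks e h1
  have : ρ₂.card ≤ Fintype.card ι₂ := m₂.card_rows ▸ Finset.card_le_univ _
  rw [h3, hcost]
  have := minAssign_le_of_le_card hT m₁ (t := t) (by omega)
  linarith [cost_nonneg hB ρ₂]

lemma minAssign_glue_le_add {σ : Finset (ι₁ × κ)} (hσ : IsMatching σ)
    (hκ : σ.card + Fintype.card ι₂ ≤ Fintype.card κ) :
    minAssign (σ.card + Fintype.card ι₂) (glue e T B) ≤
      cost T σ + minAssign (Fintype.card ι₂) (deleteCols (cols σ) B) := by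
  obtain ⟨τ, h1, h2, h3, h4⟩ := exists_cost_eq_minAssign_deleteCols (K := cols σ) le_rfl
    (by rw [hσ.card_cols]; omega) B
  obtain ⟨ρ, r1, r2, r3⟩ := exists_join e hσ h1 h3
  rw [h4, ← r3]
  exact minAssign_le _ r1 (by omega)

lemma minAssign_deleteCols_nonneg {ι κ : Type*} {X : ι × κ → ℝ} (hX : ∀ p, 0 ≤ X p)
    (K : Finset κ) (k : ℕ) : 0 ≤ minAssign k (deleteCols K X) :=
  minAssign_nonneg (fun _ => hX _) k

lemma minAssign_deleteCols_le_sum (hB : ∀ p, 0 ≤ B p) {K : Finset κ}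
    (hκ : Fintype.card ι₂ + K.card ≤ Fintype.card κ) :
    minAssign (Fintype.card ι₂) (deleteCols K B) ≤ ∑ p, B p := by
  obtain ⟨τ, -, -, -, h⟩ := exists_cost_eq_minAssign_deleteCols le_rfl hκ B
  exact h ▸ cost_le_sum hB τ

/-- With `minAssign_le_minAssign_glue` this confines the difference between 0 and the sum of `B`,
uniformly in nonnegative `T`: the domination needed for the limit. -/
lemma minAssign_glue_sub_le (hB : ∀ p, 0 ≤ B p) {t : ℕ}
    (ht : t ≤ Fintype.card ι₁) (hκ : t + Fintype.card ι₂ ≤ Fintype.card κ) :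
    minAssign (t + Fintype.card ι₂) (glue e T B) - minAssign t T ≤ ∑ p, B p := by
  obtain ⟨σ, h1, rfl, h3⟩ := exists_cost_eq_minAssign ht (by omega) T
  have := minAssign_glue_le_add e (T := T) (B := B) h1 hκ
  have := minAssign_deleteCols_le_sum hB (K := cols σ) (by rw [h1.card_cols]; omega)
  linarith

/-- If the top block has no two nearly equal costs, the optimal matching of the whole matrix
consists of the optimal one in the top block and the best completion in the remaining columns of
the bottom block. -/
lemma minAssign_glue_sub_eq (hT : ∀ p, 0 ≤ T p) (hB : ∀ p, 0 ≤ B p) {t : ℕ}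
    (ht : t ≤ Fintype.card ι₁) (hκ : t + Fintype.card ι₂ ≤ Fintype.card κ)
    (hcl : T ∉ closeCosts ι₁ κ (∑ p, B p)) :
    minAssign (t + Fintype.card ι₂) (glue e T B) - minAssign t T =
      ∑ K ∈ Finset.powersetCard t (Finset.univ : Finset κ),
        (optEvent ι₁ K).indicator
          (fun _ => minAssign (Fintype.card ι₂) (deleteCols K B)) T := by
  classical
  have hb : 0 ≤ ∑ p, B p := Finset.sum_nonneg fun p _ => hB p
  have hfar : ∀ ρ σ : Finset (ι₁ × κ), ρ ≠ σ → cost T σ ≤ cost T ρ →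
      cost T σ + ∑ p, B p < cost T ρ := fun ρ σ hne hle => by
    by_contra! h
    exact hcl ⟨ρ, σ, hne, by rw [abs_le]; constructor <;> linarith⟩
  obtain ⟨σ, h1, h2, h3⟩ := exists_cost_eq_minAssign ht (by omega) T
  have hσmin : ∀ τ, IsMatching τ → t ≤ τ.card → cost T σ ≤ cost T τ := fun τ hτ h =>
    h3 ▸ minAssign_le_of_le_card hT hτ h
  have hcard : (cols σ).card = t := h1.card_cols.trans h2
  -- Only the column set of the optimal `σ` contributes: an optimal matching with other columns
  -- would tie with `σ`.
  rw [Finset.sum_eq_single (cols σ)]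
  · have hmem : T ∈ optEvent ι₁ (cols σ) := ⟨σ, h1, rfl, fun τ hτ h => hσmin τ hτ (by omega)⟩
    rw [Set.indicator_of_mem hmem]
    have hup := minAssign_glue_le_add e (T := T) (B := B) h1 (by omega)
    rw [h2] at hup
    obtain ⟨ρ, r1, r2, r3⟩ := exists_cost_eq_minAssign
      (by rw [← Fintype.card_congr e, Fintype.card_sum]; omega) hκ (glue e T B)
    obtain ⟨ρ₁, ρ₂, m₁, m₂, hd, hc, hcost⟩ := exists_blocks e r1
    have hc₂ : ρ₂.card ≤ Fintype.card ι₂ := m₂.card_rows ▸ Finset.card_le_univ _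
    have hle := minAssign_deleteCols_le_sum hB (K := cols σ) (by omega)
    have hn := cost_nonneg hB ρ₂
    -- A top part other than `σ`, of size `t` or more, exceeds `σ` by more than the sum of `B`,
    -- hence by more than a completion of `σ` costs.
    have hρσ : ρ₁ = σ := by
      by_contra hne
      have := hfar ρ₁ σ hne (hσmin ρ₁ m₁ (by omega))
      rw [r3, hcost] at hup
      linarith
    subst hρσ
    have := minAssign_deleteCols_le (cols ρ₁) B m₂ hd (k := Fintype.card ι₂) (by omega)
    rw [h3]
    rw [r3, hcost] at hup ⊢
    linarith
  · intro K hK hne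
    refine Set.indicator_of_notMem ?_ _
    rintro ⟨τ, hτ, hcτ, hopt⟩
    have hKt : K.card = t := (Finset.mem_powersetCard.1 hK).2
    have hτt : τ.card = t := by rw [← hτ.card_cols, hcτ, hKt]
    have e1 := hopt σ h1 (by omega)
    by_cases h : τ = σ
    · exact hne (by rw [← hcτ, h])
    · have := hfar τ σ h (hσmin τ hτ hτt.ge)
      linarith
  · intro h
    exact absurd (Finset.mem_powersetCard.2 ⟨Finset.subset_univ _, hcard⟩) h

end Blocks

/-! ### Passage to the limit in the two blocks. -/

section Limits

lemma ae_nonneg_expMatrixLaw {ι κ : Type*} [Fintype ι] [Fintype κ] {A : ι × κ → ℝ}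
    (hA : ∀ p, 0 < A p) : ∀ᵐ X ∂expMatrixLaw A, ∀ p, 0 ≤ X p := by
  have := fun p => isProbabilityMeasure_expMeasure (hA p)
  exact ae_all_iff.2 fun p => (measurePreserving_eval
    (fun p => expMeasure (A p)) p).quasiMeasurePreserving.ae (ae_nonneg_expMeasure (A p))

lemma integrable_sum_entries {ι κ : Type*} [Fintype ι] [Fintype κ] {A : ι × κ → ℝ}
    (hA : ∀ p, 0 < A p) : Integrable (fun X : ι × κ → ℝ => ∑ p, X p) (expMatrixLaw A) := by
  have := fun p => isProbabilityMeasure_expMeasure (hA p)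
  exact integrable_finsetSum _ fun p _ => (measurePreserving_eval
    (fun p => expMeasure (A p)) p).integrable_comp_of_integrable (integrable_expMeasure (hA p))

lemma measurable_minAssign {ι κ : Type*} [Fintype ι] [Fintype κ] (k : ℕ) :
    Measurable fun X : ι × κ → ℝ => minAssign k X :=
  Measurable.iInf fun σ => measurable_cost σ.1

lemma measurable_glue {ι ι₁ ι₂ κ : Type*} (e : ι₁ ⊕ ι₂ ≃ ι) :
    Measurable fun z : (ι₁ × κ → ℝ) × (ι₂ × κ → ℝ) => glue e z.1 z.2 := by
  refine measurable_pi_iff.2 fun p => ?_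
  simp only [glue]
  cases e.symm p.1 <;> simp only [Sum.elim_inl, Sum.elim_inr] <;> fun_prop

lemma measurePreserving_glue {ι ι₁ ι₂ κ : Type*} [Fintype ι] [Fintype ι₁] [Fintype ι₂]
    [Fintype κ] (e : ι₁ ⊕ ι₂ ≃ ι) {A : ι × κ → ℝ} (hA : ∀ p, 0 < A p) :
    MeasurePreserving (fun z : (ι₁ × κ → ℝ) × (ι₂ × κ → ℝ) => glue e z.1 z.2)
      ((expMatrixLaw fun p => A (e (.inl p.1), p.2)).prod
        (expMatrixLaw fun p => A (e (.inr p.1), p.2))) (expMatrixLaw A) := by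
  have := fun p => isProbabilityMeasure_expMeasure (hA p)
  let E : (ι₁ × κ) ⊕ (ι₂ × κ) ≃ ι × κ :=
    (Equiv.sumProdDistrib ι₁ ι₂ κ).symm.trans (e.prodCongr (Equiv.refl κ))
  have h := (measurePreserving_piCongrLeft (fun q => expMeasure (A q)) E).comp
    (measurePreserving_sumPiEquivProdPi_symm (fun q => expMeasure (A (E q))))
  convert h using 1
  · funext z p
    obtain ⟨q, rfl⟩ := E.surjective p
    simp only [Function.comp_apply, MeasurableEquiv.coe_piCongrLeft, Equiv.piCongrLeft_apply_apply]
    rcases q with ⟨i, j⟩ | ⟨i, j⟩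
    · exact glue_inl e z.1 z.2 i j
    · exact glue_inr e z.1 z.2 i j
  · rfl
  · rfl

/-- A subfamily of independent entries is independent with the same marginals. -/
lemma measurePreserving_deleteCols {ι κ : Type*} [Fintype ι] [Fintype κ] [DecidableEq κ]
    {A : ι × κ → ℝ} (hA : ∀ p, 0 < A p) (K : Finset κ) :
    MeasurePreserving (deleteCols (ι := ι) K) (expMatrixLaw A)
      (expMatrixLaw (deleteCols K A)) := by
  have := fun p => isProbabilityMeasure_expMeasure (hA p)
  have hp := isProbabilityMeasure_expMatrixLaw hA
  refine ⟨measurable_pi_iff.2 fun p => measurable_pi_apply _, ?_⟩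
  have h1 : iIndepFun (fun (p : ι × κ) (X : ι × κ → ℝ) => X p) (expMatrixLaw A) :=
    iIndepFun_pi (X := fun _ x => x) (μ := fun p => expMeasure (A p)) fun p => aemeasurable_id
  have hinj : Function.Injective fun p : ι × {j // j ∉ K} => (p.1, (p.2 : κ)) := fun p q h =>
    Prod.ext (Prod.ext_iff.1 h).1 (Subtype.ext (Prod.ext_iff.1 h).2)
  have h2 := (iIndepFun_iff_map_fun_eq_pi_map
    (fun p => (measurable_pi_apply _).aemeasurable)).1 (h1.precomp hinj)
  refine h2.trans ?_
  rw [expMatrixLaw]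
  congr 1
  funext p
  exact (measurePreserving_eval (fun p => expMeasure (A p)) _).map_eq

variable {ι₁ ι₂ κ : Type*} [Fintype ι₁] [Fintype ι₂] [Fintype κ]

/-- The probability that two distinct sets of positions have nearly equal costs tends to `0` with
the rates of the rows. -/
lemma tendsto_closeCosts {c : κ → ℝ} (hc : ∀ j, 0 < c j) {b : ℝ} (hb : 0 ≤ b) :
    Filter.Tendsto (fun u : ι₁ → ℝ =>
        (expMatrixLaw fun p : ι₁ × κ => u p.1 * c p.2).real (closeCosts ι₁ κ b))
      (nhdsWithin 0 {u | ∀ i, 0 < u i}) (nhds 0) := by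
  set N : ℝ := (Fintype.card (Finset (ι₁ × κ)) : ℝ) ^ 2
  have hlim : Filter.Tendsto (fun u : ι₁ → ℝ => N * (2 * b * ∑ p : ι₁ × κ, u p.1 * c p.2))
      (nhdsWithin 0 {u | ∀ i, 0 < u i}) (nhds 0) := by
    have : Continuous fun u : ι₁ → ℝ => N * (2 * b * ∑ p : ι₁ × κ, u p.1 * c p.2) := by fun_prop
    simpa using (this.tendsto 0).mono_left nhdsWithin_le_nhds
  refine squeeze_zero' (Filter.Eventually.of_forall fun u => measureReal_nonneg) ?_ hlim
  filter_upwards [self_mem_nhdsWithin] with u hu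
  have hA : ∀ p : ι₁ × κ, 0 < u p.1 * c p.2 := fun p => mul_pos (hu _) (hc _)
  have hs : 0 ≤ ∑ p : ι₁ × κ, u p.1 * c p.2 := Finset.sum_nonneg fun p _ => (hA p).le
  have h := ENNReal.toReal_mono (by finiteness) (measure_closeCosts_le hA b)
  rw [ENNReal.toReal_mul, ENNReal.toReal_ofReal (by positivity), ENNReal.toReal_pow,
    ENNReal.toReal_natCast] at h
  exact h

/-- Two bounded functions that agree off `closeCosts` have asymptotically equal expectations. -/
lemma tendsto_integral_of_eq {c : κ → ℝ} (hc : ∀ j, 0 < c j) {Φ Ψ : (ι₁ × κ → ℝ) → ℝ}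
    (hΦ : Measurable Φ) (hΨ : Measurable Ψ) {b C I : ℝ} (hb : 0 ≤ b)
    (hΦC : ∀ T, (∀ p, 0 ≤ T p) → |Φ T| ≤ C) (hΨC : ∀ T, (∀ p, 0 ≤ T p) → |Ψ T| ≤ C)
    (heq : ∀ T, (∀ p, 0 ≤ T p) → T ∉ closeCosts ι₁ κ b → Φ T = Ψ T)
    (hI : ∀ u : ι₁ → ℝ, (∀ i, 0 < u i) →
      ∫ T, Ψ T ∂expMatrixLaw (fun p : ι₁ × κ => u p.1 * c p.2) = I) :
    Filter.Tendsto (fun u : ι₁ → ℝ => ∫ T, Φ T ∂expMatrixLaw fun p : ι₁ × κ => u p.1 * c p.2)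
      (nhdsWithin 0 {u | ∀ i, 0 < u i}) (nhds I) := by
  rw [tendsto_iff_norm_sub_tendsto_zero]
  have hlim := (tendsto_closeCosts (ι₁ := ι₁) hc hb).const_mul (C + C)
  rw [mul_zero] at hlim
  refine squeeze_zero' (Filter.Eventually.of_forall fun u => norm_nonneg _) ?_ hlim
  filter_upwards [self_mem_nhdsWithin] with u hu
  have hA : ∀ p : ι₁ × κ, 0 < u p.1 * c p.2 := fun p => mul_pos (hu _) (hc _)
  have := isProbabilityMeasure_expMatrixLaw hA
  have hpos := ae_nonneg_expMatrixLaw hA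
  have iΦ : Integrable Φ (expMatrixLaw fun p : ι₁ × κ => u p.1 * c p.2) :=
    Integrable.of_bound hΦ.aestronglyMeasurable C (hpos.mono hΦC)
  have iΨ : Integrable Ψ (expMatrixLaw fun p : ι₁ × κ => u p.1 * c p.2) :=
    Integrable.of_bound hΨ.aestronglyMeasurable C (hpos.mono hΨC)
  have hm := measurableSet_closeCosts ι₁ κ b
  -- The integral of `Ψ` is `I` for every admissible `u`, so the error is the integral of `Φ - Ψ`,
  -- which is at most `C + C` in absolute value and vanishes off `closeCosts`.
  rw [← hI u hu, ← integral_sub iΦ iΨ]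
  refine (norm_integral_le_of_norm_le (g := (closeCosts ι₁ κ b).indicator fun _ => C + C)
    ((integrable_const _).indicator hm) ?_).trans ?_
  · filter_upwards [hpos] with T hT
    by_cases h : T ∈ closeCosts ι₁ κ b
    · rw [Set.indicator_of_mem h]
      exact (norm_sub_le _ _).trans (add_le_add (hΦC T hT) (hΨC T hT))
    · rw [Set.indicator_of_notMem h, heq T hT h, sub_self, norm_zero]
  · rw [integral_indicator_const _ hm, smul_eq_mul, mul_comm]

lemma integrable_prod_of_le_sum {A₁ : ι₁ × κ → ℝ} (hA₁ : ∀ p, 0 < A₁ p) {A₂ : ι₂ × κ → ℝ}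
    (hA₂ : ∀ p, 0 < A₂ p) {Φ : (ι₁ × κ → ℝ) × (ι₂ × κ → ℝ) → ℝ} (hΦ : Measurable Φ)
    (hle : ∀ T B, (∀ p, 0 ≤ T p) → (∀ p, 0 ≤ B p) → |Φ (T, B)| ≤ ∑ p, B p) :
    Integrable Φ ((expMatrixLaw A₁).prod (expMatrixLaw A₂)) := by
  have := isProbabilityMeasure_expMatrixLaw hA₁
  have := isProbabilityMeasure_expMatrixLaw hA₂
  refine Integrable.mono' ((integrable_sum_entries hA₂).comp_snd (expMatrixLaw A₁))
    hΦ.aestronglyMeasurable ?_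
  filter_upwards [Measure.quasiMeasurePreserving_fst.ae (ae_nonneg_expMatrixLaw hA₁),
    Measure.quasiMeasurePreserving_snd.ae (ae_nonneg_expMatrixLaw hA₂)] with z h1 h2
  exact hle z.1 z.2 h1 h2

/-- Dominated convergence in the bottom block. -/
lemma tendsto_integral_prod {c : κ → ℝ} (hc : ∀ j, 0 < c j) {A₂ : ι₂ × κ → ℝ}
    (hA₂ : ∀ p, 0 < A₂ p) {Φ : (ι₁ × κ → ℝ) × (ι₂ × κ → ℝ) → ℝ} (hΦ : Measurable Φ)
    (hle : ∀ T B, (∀ p, 0 ≤ T p) → (∀ p, 0 ≤ B p) → |Φ (T, B)| ≤ ∑ p, B p)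
    {L : (ι₂ × κ → ℝ) → ℝ}
    (hL : ∀ B, (∀ p, 0 ≤ B p) → Filter.Tendsto
      (fun u : ι₁ → ℝ => ∫ T, Φ (T, B) ∂expMatrixLaw fun p : ι₁ × κ => u p.1 * c p.2)
      (nhdsWithin 0 {u | ∀ i, 0 < u i}) (nhds (L B))) :
    Filter.Tendsto (fun u : ι₁ → ℝ => ∫ z, Φ z
        ∂(expMatrixLaw fun p : ι₁ × κ => u p.1 * c p.2).prod (expMatrixLaw A₂))
      (nhdsWithin 0 {u | ∀ i, 0 < u i}) (nhds (∫ B, L B ∂expMatrixLaw A₂)) := by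
  have := isProbabilityMeasure_expMatrixLaw hA₂
  have hpos₂ := ae_nonneg_expMatrixLaw hA₂
  -- `T` is integrated first, with `B` frozen, so that the threshold in `closeCosts` may depend on
  -- `B`. The outer law does not depend on `u`, and the sum of `B` dominates.
  have hdct : Filter.Tendsto (fun u : ι₁ → ℝ => ∫ B, ∫ T, Φ (T, B)
        ∂expMatrixLaw (fun p : ι₁ × κ => u p.1 * c p.2) ∂expMatrixLaw A₂)
      (nhdsWithin 0 {u | ∀ i, 0 < u i}) (nhds (∫ B, L B ∂expMatrixLaw A₂)) := by
    refine tendsto_integral_filter_of_dominated_convergence (fun B => ∑ p, B p) ?_ ?_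
      (integrable_sum_entries hA₂) (hpos₂.mono hL)
    · filter_upwards [self_mem_nhdsWithin] with u hu
      have hA : ∀ p : ι₁ × κ, 0 < u p.1 * c p.2 := fun p => mul_pos (hu _) (hc _)
      have := isProbabilityMeasure_expMatrixLaw hA
      exact (integrable_prod_of_le_sum hA hA₂ hΦ hle).integral_prod_right.aestronglyMeasurable
    · filter_upwards [self_mem_nhdsWithin] with u hu
      have hA : ∀ p : ι₁ × κ, 0 < u p.1 * c p.2 := fun p => mul_pos (hu _) (hc _)
      have := isProbabilityMeasure_expMatrixLaw hA
      filter_upwards [hpos₂] with B hB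
      refine (norm_integral_le_of_norm_le_const (C := ∑ p, B p) ?_).trans (by simp)
      exact (ae_nonneg_expMatrixLaw hA).mono fun T hT => hle T B hT hB
  refine hdct.congr' ?_
  filter_upwards [self_mem_nhdsWithin] with u hu
  have hA : ∀ p : ι₁ × κ, 0 < u p.1 * c p.2 := fun p => mul_pos (hu _) (hc _)
  have := isProbabilityMeasure_expMatrixLaw hA
  exact (integral_prod_symm _ (integrable_prod_of_le_sum hA hA₂ hΦ hle)).symm

variable {ι : Type*} [Fintype ι]

lemma E_eq_integral_prod (e : ι₁ ⊕ ι₂ ≃ ι) {r : ι → ℝ} (hr : ∀ i, 0 < r i) {c : κ → ℝ}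
    (hc : ∀ j, 0 < c j) (k : ℕ) :
    E k r c = ∫ z, minAssign k (glue e z.1 z.2)
      ∂(expMatrixLaw fun p : ι₁ × κ => r (e (.inl p.1)) * c p.2).prod
        (expMatrixLaw fun p : ι₂ × κ => r (e (.inr p.1)) * c p.2) := by
  have h := measurePreserving_glue e (A := fun p : ι × κ => r p.1 * c p.2)
    fun p => mul_pos (hr _) (hc _)
  rw [E, expMinAssign, ← h.map_eq, integral_map h.measurable.aemeasurable
    (measurable_minAssign k).aestronglyMeasurable]

variable [DecidableEq κ]

lemma tendsto_integral_minAssign_glue (e : ι₁ ⊕ ι₂ ≃ ι) {c : κ → ℝ} (hc : ∀ j, 0 < c j)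
    {B : ι₂ × κ → ℝ} (hB : ∀ p, 0 ≤ B p) {k : ℕ} (hk : k ≤ Fintype.card ι₂)
    (hκ : k ≤ Fintype.card κ) :
    Filter.Tendsto (fun u : ι₁ → ℝ => ∫ T, minAssign k (glue e T B)
        ∂expMatrixLaw fun p : ι₁ × κ => u p.1 * c p.2)
      (nhdsWithin 0 {u | ∀ i, 0 < u i}) (nhds (minAssign k B)) := by
  have hle := minAssign_le_sum hB hk hκ
  refine tendsto_integral_of_eq hc (Φ := fun T => minAssign k (glue e T B))
    (Ψ := fun _ => minAssign k B) (b := ∑ p, B p) (C := ∑ p, B p)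
    ((measurable_minAssign k).comp ((measurable_glue e).comp measurable_prodMk_right))
    measurable_const (Finset.sum_nonneg fun p _ => hB p) (fun T hT => ?_) (fun T hT => ?_)
    (fun T hT h => minAssign_glue_eq e hT hB hk hκ h) fun u hu => ?_
  · have hn : ∀ p, 0 ≤ glue e T B p := fun p => by
      simp only [glue]
      cases e.symm p.1 <;> simp [hT, hB]
    rw [abs_of_nonneg (minAssign_nonneg hn k)]
    exact (minAssign_glue_le e hk hκ).trans hle
  · rwa [abs_of_nonneg (minAssign_nonneg hB k)]
  · have := isProbabilityMeasure_expMatrixLaw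
      (A := fun p : ι₁ × κ => u p.1 * c p.2) fun p => mul_pos (hu _) (hc _)
    simp

/-- For fixed `B` the comparison function of `minAssign_glue_sub_eq` has, by `measureReal_optEvent`,
the same integral for every `u`, namely the limit. -/
lemma tendsto_integral_minAssign_glue_sub [DecidableEq ι₁] (e : ι₁ ⊕ ι₂ ≃ ι) {c : κ → ℝ}
    (hc : ∀ j, 0 < c j)
    {B : ι₂ × κ → ℝ} (hB : ∀ p, 0 ≤ B p) {t : ℕ} (ht : t ≤ Fintype.card ι₁)
    (hκ : t + Fintype.card ι₂ ≤ Fintype.card κ) :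
    Filter.Tendsto (fun u : ι₁ → ℝ => ∫ T,
        (minAssign (t + Fintype.card ι₂) (glue e T B) - minAssign t T)
        ∂expMatrixLaw fun p : ι₁ × κ => u p.1 * c p.2)
      (nhdsWithin 0 {u | ∀ i, 0 < u i})
      (nhds (∑ K ∈ Finset.powersetCard t (Finset.univ : Finset κ),
        Pr c K * minAssign (Fintype.card ι₂) (deleteCols K B))) := by
  have hb : 0 ≤ ∑ p, B p := Finset.sum_nonneg fun p _ => hB p
  set P := Finset.powersetCard t (Finset.univ : Finset κ)
  have hcardK : ∀ K ∈ P, K.card = t := fun K hK => (Finset.mem_powersetCard.1 hK).2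
  have hV : ∀ K ∈ P, 0 ≤ minAssign (Fintype.card ι₂) (deleteCols K B) ∧
      minAssign (Fintype.card ι₂) (deleteCols K B) ≤ ∑ p, B p := fun K hK =>
    ⟨minAssign_deleteCols_nonneg hB K _,
      minAssign_deleteCols_le_sum hB (by rw [hcardK K hK]; omega)⟩
  -- The constant `C` serves both functions: `Φ` is at most the sum of `B`, and `Ψ` at most `P.card`
  -- times it.
  refine tendsto_integral_of_eq hc
    (Φ := fun T => minAssign (t + Fintype.card ι₂) (glue e T B) - minAssign t T)
    (Ψ := fun T => ∑ K ∈ P, (optEvent ι₁ K).indicator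
      (fun _ => minAssign (Fintype.card ι₂) (deleteCols K B)) T)
    (b := ∑ p, B p) (C := (P.card + 1) * ∑ p, B p)
    (((measurable_minAssign _).comp ((measurable_glue e).comp measurable_prodMk_right)).sub
      (measurable_minAssign t))
    (Finset.measurable_sum _ fun K _ => measurable_const.indicator (measurableSet_optEvent K))
    hb (fun T hT => ?_) (fun T hT => ?_)
    (fun T hT h => minAssign_glue_sub_eq e hT hB ht hκ h) fun u hu => ?_
  · rw [abs_of_nonneg (sub_nonneg.2 (minAssign_le_minAssign_glue e hT hB ht hκ))]
    refine (minAssign_glue_sub_le e hB ht hκ).trans ?_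
    have : 0 ≤ (P.card : ℝ) * ∑ p, B p := by positivity
    linarith
  · have h0 : ∀ K ∈ P, 0 ≤ (optEvent ι₁ K).indicator
        (fun _ => minAssign (Fintype.card ι₂) (deleteCols K B)) T ∧
        (optEvent ι₁ K).indicator
        (fun _ => minAssign (Fintype.card ι₂) (deleteCols K B)) T ≤ ∑ p, B p := fun K hK => by
      by_cases h : T ∈ optEvent ι₁ K
      · rw [Set.indicator_of_mem h]; exact hV K hK
      · rw [Set.indicator_of_notMem h]; exact ⟨le_rfl, hb⟩
    rw [abs_of_nonneg (Finset.sum_nonneg fun K hK => (h0 K hK).1)]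
    refine (Finset.sum_le_card_nsmul P _ _ fun K hK => (h0 K hK).2).trans ?_
    rw [nsmul_eq_mul]
    linarith
  · have := isProbabilityMeasure_expMatrixLaw
      (A := fun p : ι₁ × κ => u p.1 * c p.2) fun p => mul_pos (hu _) (hc _)
    rw [integral_finsetSum _ fun K _ =>
      (integrable_const _).indicator (measurableSet_optEvent K)]
    refine Finset.sum_congr rfl fun K hK => ?_
    rw [integral_indicator_const _ (measurableSet_optEvent K), smul_eq_mul,
      measureReal_optEvent hu hc K (by rw [hcardK K hK]; exact ht)]

lemma integral_minAssign_deleteCols {r : ι₂ → ℝ} (hr : ∀ i, 0 < r i) {c : κ → ℝ}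
    (hc : ∀ j, 0 < c j) (k : ℕ) (K : Finset κ) :
    ∫ B, minAssign k (deleteCols K B) ∂(expMatrixLaw fun p : ι₂ × κ => r p.1 * c p.2) =
      E k r fun j : {j // j ∉ K} => c j := by
  have h := measurePreserving_deleteCols (A := fun p : ι₂ × κ => r p.1 * c p.2)
    (fun p => mul_pos (hr _) (hc _)) K
  rw [E, expMinAssign, ← integral_map h.measurable.aemeasurable
    (measurable_minAssign k).aestronglyMeasurable, h.map_eq]
  rfl

end Limits

end MinAssign

/-! ### The theorem. -/

/-- Here `m = l + d`: the first `l` rates are `u`, the remaining `d = m - l` rates are `s`, and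
`k - d = k + l - m`. The limits are taken as all entries of `u` tend to `0` jointly through
positive values. -/
theorem mainTheorem5 (k l d n : ℕ) (hk : 0 < k) (hkm : k ≤ l + d) (hmn : l + d ≤ n)
    (s : Fin d → ℝ) (hs : ∀ i, 0 < s i) (c : Fin n → ℝ) (hc : ∀ j, 0 < c j) :
    (k ≤ d →
      Filter.Tendsto (fun u : Fin l → ℝ => MinAssign.E k (Fin.append u s) c)
        (nhdsWithin 0 {u | ∀ i, 0 < u i}) (nhds (MinAssign.E k s c))) ∧
    (0 < d → d < k →
      Filter.Tendsto
        (fun u : Fin l → ℝ => MinAssign.E k (Fin.append u s) c - MinAssign.E (k - d) u c)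
        (nhdsWithin 0 {u | ∀ i, 0 < u i})
        (nhds (∑ K ∈ Finset.powersetCard (k - d) (Finset.univ : Finset (Fin n)),
          MinAssign.Pr c K * MinAssign.E d s (fun j : {j : Fin n // j ∉ K} => c j)))) := by
  open MinAssign in
  set e : Fin l ⊕ Fin d ≃ Fin (l + d) := finSumFinEquiv
  have hA₂ : ∀ p : Fin d × Fin n, 0 < s p.1 * c p.2 := fun p => mul_pos (hs _) (hc _)
  have := isProbabilityMeasure_expMatrixLaw hA₂
  have hE : ∀ u : Fin l → ℝ, (∀ i, 0 < u i) → E k (Fin.append u s) c =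
      ∫ z, minAssign k (glue e z.1 z.2) ∂(expMatrixLaw fun p : Fin l × Fin n => u p.1 * c p.2).prod
        (expMatrixLaw fun p : Fin d × Fin n => s p.1 * c p.2) := fun u hu => by
    have hr : ∀ i, 0 < Fin.append u s i := fun i => by
      refine Fin.addCases (fun i => ?_) (fun i => ?_) i <;> simp [hu, hs]
    simpa [e] using E_eq_integral_prod e hr hc k
  have hglue : Measurable fun z : (Fin l × Fin n → ℝ) × (Fin d × Fin n → ℝ) =>
      minAssign k (glue e z.1 z.2) := (measurable_minAssign k).comp (measurable_glue e)
  constructor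
  · intro hkd
    have hk₂ : k ≤ Fintype.card (Fin d) := by simpa using hkd
    have hkn : k ≤ Fintype.card (Fin n) := by simp; omega
    refine (tendsto_integral_prod hc hA₂ hglue (fun T B hT hB => ?_) fun B hB =>
      tendsto_integral_minAssign_glue e hc hB hk₂ hkn).congr' ?_
    · have hn : ∀ p, 0 ≤ glue e T B p := fun p => by
        simp only [glue]
        cases e.symm p.1 <;> simp [hT, hB]
      rw [abs_of_nonneg (minAssign_nonneg hn k)]
      exact (minAssign_glue_le e hk₂ hkn).trans (minAssign_le_sum hB hk₂ hkn)
    · filter_upwards [self_mem_nhdsWithin] with u hu using (hE u hu).symm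
  · intro _ hdk
    obtain ⟨t, rfl⟩ : ∃ t, k = t + d := ⟨k - d, by omega⟩
    rw [Nat.add_sub_cancel]
    have ht : t ≤ Fintype.card (Fin l) := by simp; omega
    have htn : t + Fintype.card (Fin d) ≤ Fintype.card (Fin n) := by simp; omega
    have hle : ∀ (T : Fin l × Fin n → ℝ) (B : Fin d × Fin n → ℝ), (∀ p, 0 ≤ T p) →
        (∀ p, 0 ≤ B p) → |minAssign (t + d) (glue e T B) - minAssign t T| ≤ ∑ p, B p := by
      intro T B hT hB
      have h1 := minAssign_le_minAssign_glue e hT hB ht htn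
      have h2 := minAssign_glue_sub_le e (T := T) hB ht htn
      rw [Fintype.card_fin] at h1 h2
      rwa [abs_of_nonneg (sub_nonneg.2 h1)]
    have hmeas : Measurable fun z : (Fin l × Fin n → ℝ) × (Fin d × Fin n → ℝ) =>
        minAssign (t + d) (glue e z.1 z.2) - minAssign t z.1 :=
      hglue.sub ((measurable_minAssign t).comp measurable_fst)
    have hlim := tendsto_integral_prod (ι₁ := Fin l) hc hA₂ hmeas hle fun B hB => by
      simpa using tendsto_integral_minAssign_glue_sub e hc hB ht htn
    rw [integral_finsetSum _ fun K _ => by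
      have h := measurePreserving_deleteCols hA₂ K
      exact (h.integrable_comp_of_integrable
        (integrable_minAssign d fun p => hA₂ (p.1, p.2))).const_mul _] at hlim
    simp only [integral_const_mul, integral_minAssign_deleteCols hs hc] at hlim
    refine hlim.congr' ?_
    filter_upwards [self_mem_nhdsWithin] with u hu
    have hA₁ : ∀ p : Fin l × Fin n, 0 < u p.1 * c p.2 := fun p => mul_pos (hu _) (hc _)
    have := isProbabilityMeasure_expMatrixLaw hA₁
    -- For each fixed `u` the term `minAssign t T` is integrable, so adding it back turns the
    -- expected difference into the difference of the expectations.
    have hfst := (integrable_minAssign t hA₁).comp_fst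
      (expMatrixLaw fun p : Fin d × Fin n => s p.1 * c p.2)
    have hsub := integrable_prod_of_le_sum hA₁ hA₂ hmeas hle
    have h1 := integral_add hsub hfst
    simp only [sub_add_cancel] at h1
    rw [hE u hu, h1, integral_fun_fst (fun T => minAssign t T)]
    simp [E, expMinAssign]
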